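/- **Setting.** Let $d\ge 1$, $C,L\ge 0$, $\mu,\zeta>0$, $\beta_1\in(0,1)$. Let $\xi$ be a random variable with law $D$, let $f(\theta;\xi)$, $\theta\in\mathbb R^d$, be jointly measurable, and let $F(\theta)=\mathbb E_\xi[f(\theta;\xi)]$ be differentiable. Assume for all $\theta,\theta'\in\mathbb R^d$ and all $i\in\{1,\dots,d\}$: $|f(\theta;\xi)|\le C$; $|\nabla_iF(\theta)-\nabla_iF(\theta')|\le L\|\theta-\theta'\|$; $\mathbb E_\xi|f(\theta;\xi)-F(\theta)|^2\le\sigma^2$. Given $K\ge1$ directions $u_1,\dots,u_K$, put $$\hat\nabla f(\theta,\xi)=\frac dK\sum_{k=1}^K\frac{f(\theta+\mu u_k;\xi)-f(\theta;\xi)}{\mu}\,u_k .$$ ZO-AdaMM with step size $\eta>0$ starts from $\theta_0\in\mathbb R^d$, $m_0=0$, and $v_0$ with $v_{0,i}>0$ for all $i$, and iterates for $t\ge1$ (coordinatewise operations) $$g_t=\hat\nabla f(\theta_{t-1},\xi_t),\quad m_t=\beta_1m_{t-1}+(1-\beta_1)g_t,\quad v_t=\beta_2v_{t-1}+(1-\beta_2)g_t^2,\quad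 \theta_t=\theta_{t-1}-\eta\,\frac{m_t}{\sqrt{v_t+\zeta}},$$ where at each iteration $\xi_t\sim D$ and $K$ directions uniform on the unit sphere are drawn, all independent of each other and across iterations. Norms are Euclidean. Let $\Sigma^2=\frac{8(\sigma^2+C^2)d}{K\mu^2}$, $\hat V=\sqrt{\|v_0\|+(1+\beta_1)\Sigma^2}$, let $F_\mu(\theta)=\mathbb E[F(\theta+\mu w)]$ with $w$ uniform on the unit ball, and for $W\ge0$ let $$B(W)=\frac{(1+\beta_1)\sqrt d}{\sqrt{\beta_1(1-\beta_2)}}\,\epsilon^2+\Big(\zeta^{1/4}+\sqrt{Wd}\Big)\epsilon+\mu L\sqrt d .$$ **Theorem.** 1. There are $c_2,c_\eta>0$, depending only on $d,C,L,\mu,\zeta,\beta_1$, such that for all $a_2,a_\eta>0$ and all $v_0$ with positive coordinates there is $c_T>0$, depending only on these quantities, such that the following holds for all $f,D,\sigma,K,\theta_0$ as above and all $0<\epsilon\le1$. If $\frac12\le\beta_2<1$, $\beta_1\le\sqrt{\beta_2}$, $a_2\epsilon^2\le1-\beta_2\le c_2\epsilon^2$, $a_\eta\epsilon^2\le\eta\le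 c_\eta\epsilon^2$ and $T\ge c_T\epsilon^{-4}$, then all $\|\nabla F(\theta_t)\|$, $t<T$, are integrable and $$\frac1T\sum_{t=0}^{T-1}\mathbb E\,\|\nabla F(\theta_t)\|\le B(\hat V).\qquad(*)$$ 2. $(*)$ also holds, with the same integrability, for every $\epsilon>0$, $\eta>0$, $T\ge1$ and $\frac12\le\beta_2<1$ with $\beta_1<\sqrt{\beta_2}$, under the explicit conditions (with $\Delta=F_\mu(\theta_0)-\inf F_\mu$) $$(1-\beta_2)\Big(\frac{8C^2d^3}{(1-\beta_1^2/\beta_2)\mu^2\sqrt\zeta}+\frac{2\beta_1^2d\sqrt\zeta}{1-\beta_1^2/\beta_2}\Big)\le\frac{\epsilon^2}3,\qquad \eta\,\frac{16Ld\sqrt d\,(1-\beta_1)}{(1-\beta_1/\sqrt{\beta_2})^3}\le\frac{\epsilon^2}3,$$ $$T\ge\frac3{\epsilon^2}\Big(\frac{2(1-\beta_1/\sqrt{\beta_2})\Delta}{\eta(1-\beta_1)}+\frac{8C^2d^3}{(1-\beta_1^2/\beta_2)\mu^2\sqrt\zeta}+\frac{8L\eta\sqrt d(1-\beta_1)}{(1-\beta_1/\sqrt{\beta_2})^3}\sum_{i=1}^d\frac{\ln\big((\beta_2^Tv_{0,i}+4C^2d^2/\mu^2)/v_{0,i}\big)}{1-\beta_2}\Big).$$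 3. Let $\hat V(S)=\sqrt{\|v_0\|+(1+\beta_1)S}$ and let $V(S)=\sqrt{\|v_0\|+(1-\beta_1)S+\frac{\beta_1(1+\beta_1)^2L^2\eta^2d}{(1-\beta_1)^2(1-\beta_2)}}$ be the corresponding quantity in the bound $B(V(\Sigma^2))$ for R-AdaZO (the variant with $v_t=\beta_2v_{t-1}+(1-\beta_2)m_t^2$). For fixed $v_0$, $\epsilon>0$, $\eta>0$ and $\beta_2\in(0,1)$, the ratio of the two bounds satisfies, as the variance $S=\Sigma^2$ dominates, $$\lim_{S\to\infty}\frac{B(\hat V(S))}{B(V(S))}=\Big(\frac{1+\beta_1}{1-\beta_1}\Big)^{1/4}.$$ -/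

import Mathlib

open MeasureTheory ProbabilityTheory Filter Topology

noncomputable section

/-- The parameter space `ℝ^d` with its Euclidean norm. -/
abbrev Vec (d : ℕ) : Type := EuclideanSpace ℝ (Fin d)

/-- The uniform probability distribution on the unit sphere of `ℝ^d`
(normalised surface measure), as a measure on `ℝ^d`. -/
def sphereUniform (d : ℕ) : Measure (Vec d) :=
  (((volume : Measure (Vec d)).toSphere Set.univ)⁻¹ •
    (volume : Measure (Vec d)).toSphere).map Subtype.val

/-- The uniform probability distribution on the unit ball of `ℝ^d`. -/
def ballUniform (d : ℕ) : Measure (Vec d) :=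
  ProbabilityTheory.cond volume (Metric.closedBall (0 : Vec d) 1)

/-- The objective `F(θ) = E_ξ[f(θ; ξ)]`. -/
def objective {d : ℕ} {Ξ : Type*} [MeasurableSpace Ξ]
    (f : Vec d → Ξ → ℝ) (D : Measure Ξ) (θ : Vec d) : ℝ :=
  ∫ x, f θ x ∂D

/-- Randomized smoothing `F_μ(θ) = E_u[F(θ + μ u)]` with `u` uniform on the unit ball. -/
def smoothed {d : ℕ} (F : Vec d → ℝ) (μ : ℝ) (θ : Vec d) : ℝ :=
  ∫ w, F (θ + μ • w) ∂(ballUniform d)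

/-- The assumptions on the stochastic objective: `f` is (jointly) measurable and bounded by `C`,
the partial derivatives of `F` are `L`-Lipschitz, and function values have variance at
most `σ²`. -/
structure ZOAssumptions {d : ℕ} {Ξ : Type*} [MeasurableSpace Ξ]
    (f : Vec d → Ξ → ℝ) (D : Measure Ξ) (C L σ : ℝ) : Prop where
  measurable : Measurable (Function.uncurry f)
  bounded : ∀ θ x, |f θ x| ≤ C
  differentiable : Differentiable ℝ (objective f D)
  lipschitz : ∀ θ θ' : Vec d, ∀ i : Fin d,
    |gradient (objective f D) θ i - gradient (objective f D) θ' i| ≤ L * ‖θ - θ'‖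
  variance : ∀ θ, ∫ x, |f θ x - objective f D θ| ^ 2 ∂D ≤ σ ^ 2

/-- The zeroth-order gradient estimator
`(d / K) ∑ₖ (f(θ + μ uₖ; x) - f(θ; x)) / μ • uₖ`; all `K` directions share the sample `x`. -/
def zoGrad {d K : ℕ} {Ξ : Type*} (f : Vec d → Ξ → ℝ) (μ : ℝ)
    (u : Fin K → Vec d) (x : Ξ) (θ : Vec d) : Vec d :=
  ((d : ℝ) / (K : ℝ)) • ∑ k, ((f (θ + μ • u k) x - f θ x) / μ) • u k

/-- Iterate, first moment estimate and second moment estimate. -/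
structure AdaMMState (d : ℕ) where
  θ : Vec d
  m : Vec d
  v : Vec d

/-- One ZO-AdaMM update with gradient estimate `g`. Vector operations are coordinatewise. -/
def adaMMStep {d : ℕ} (β₁ β₂ η ζ : ℝ) (s : AdaMMState d) (g : Vec d) : AdaMMState d :=
  let m' : Vec d := β₁ • s.m + (1 - β₁) • g
  let v' : Vec d := WithLp.toLp 2 fun i => β₂ * s.v i + (1 - β₂) * g i ^ 2
  { θ := s.θ - η • (WithLp.toLp 2 fun i => m' i / √(v' i + ζ) : Vec d)
    m := m'
    v := v' }

/-- The ZO-AdaMM trajectory started at `(θ₀, m₀, v₀)`; the update that produces state `t + 1`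
uses the data sample `x t` and the directions `u t 0, …, u t (K - 1)`. -/
def zoAdaMM {d K : ℕ} {Ξ : Type*} (f : Vec d → Ξ → ℝ) (μ β₁ β₂ η ζ : ℝ)
    (θ₀ m₀ v₀ : Vec d) (x : ℕ → Ξ) (u : ℕ → Fin K → Vec d) : ℕ → AdaMMState d
  | 0 => { θ := θ₀, m := m₀, v := v₀ }
  | t + 1 =>
    let s := zoAdaMM f μ β₁ β₂ η ζ θ₀ m₀ v₀ x u t
    adaMMStep β₁ β₂ η ζ s (zoGrad f μ (u t) (x t) s.θ)

/-- The randomness of a run: at every iteration `t` the data sample `ξ t` has law `D`, the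
directions `u t k` are uniform on the unit sphere, and all of these are independent, within an
iteration (the joint law is a product) and across iterations. -/
structure IsZOSampling {d K : ℕ} {Ξ Ω : Type*} [MeasurableSpace Ξ] [MeasurableSpace Ω]
    (D : Measure Ξ) (P : Measure Ω) (ξ : ℕ → Ω → Ξ) (u : ℕ → Fin K → Ω → Vec d) : Prop where
  measurable : ∀ t, Measurable fun ω => (ξ t ω, fun k => u t k ω)
  law : ∀ t, P.map (fun ω => (ξ t ω, fun k => u t k ω)) =
    D.prod (Measure.pi fun _ : Fin K => sphereUniform d)
  indep : iIndepFun (fun t ω => (ξ t ω, fun k => u t k ω)) P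

/-- The random iterate `θ_t` of ZO-AdaMM, started with zero first moment. -/
def zoAdaMMIterate {d K : ℕ} {Ξ Ω : Type*} (f : Vec d → Ξ → ℝ) (μ β₁ β₂ η ζ : ℝ)
    (θ₀ v₀ : Vec d) (ξ : ℕ → Ω → Ξ) (u : ℕ → Fin K → Ω → Vec d) (t : ℕ) (ω : Ω) : Vec d :=
  (zoAdaMM f μ β₁ β₂ η ζ θ₀ 0 v₀ (fun s => ξ s ω) (fun s k => u s k ω) t).θ

/-- The variance proxy `Σ² = 8 (σ² + C²) d / (K μ²)`. -/
def sigmaSq (d K : ℕ) (σ C μ : ℝ) : ℝ :=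
  8 * (σ ^ 2 + C ^ 2) * d / (K * μ ^ 2)

/-- `V̂ = (‖v₀‖ + (1 + β₁) S)^{1/2}`, as a function of the variance `S = Σ²` (ZO-AdaMM). -/
def vHat {d : ℕ} (v₀ : Vec d) (β₁ S : ℝ) : ℝ :=
  √(‖v₀‖ + (1 + β₁) * S)

/-- `V = (‖v₀‖ + (1 - β₁) S + β₁(1+β₁)²L²η²d / ((1-β₁)²(1-β₂)))^{1/2}`, as a function of the
variance `S = Σ²` (R-AdaZO). -/
def vRefined {d : ℕ} (v₀ : Vec d) (β₁ β₂ L η S : ℝ) : ℝ :=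
  √(‖v₀‖ + (1 - β₁) * S
    + β₁ * (1 + β₁) ^ 2 * L ^ 2 * η ^ 2 * d / ((1 - β₁) ^ 2 * (1 - β₂)))

/-- The right-hand side of the convergence bounds, with `W = V̂` for ZO-AdaMM and `W = V` for
R-AdaZO. -/
def convBound (d : ℕ) (β₁ β₂ ζ ε μ L W : ℝ) : ℝ :=
  (1 + β₁) * √(d : ℝ) / √(β₁ * (1 - β₂)) * ε ^ 2
    + (ζ ^ (1 / 4 : ℝ) + √(W * d)) * ε + μ * L * √(d : ℝ)

/-- Every `‖∇F(θ_t)‖`, `t < T`, is integrable, and the average over `t < T` of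
`E‖∇F(θ_t)‖` is at most `B`. -/
def AvgGradNormLE {d : ℕ} {Ω : Type*} [MeasurableSpace Ω] (F : Vec d → ℝ) (P : Measure Ω)
    (θ : ℕ → Ω → Vec d) (T : ℕ) (B : ℝ) : Prop :=
  (∀ t < T, Integrable (fun ω => ‖gradient F (θ t ω)‖) P) ∧
    1 / (T : ℝ) * ∑ t ∈ Finset.range T, ∫ ω, ‖gradient F (θ t ω)‖ ∂P ≤ B

/-- The explicit parameter choice for accuracy `ε`: upper bounds on `1 - β₂` (of order `ε²`) and
on `η` (of order `ε²`), and a lower bound on the number of iterations `T` (of order `ε⁻⁴`), where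
`Δ` is the initial gap of the smoothed objective. -/
structure AdmissibleParams {d : ℕ} (C L μ ζ β₁ β₂ η ε Δ : ℝ) (v₀ : Vec d) (T : ℕ) : Prop where
  beta₂ : (1 - β₂) * (8 * C ^ 2 * d ^ 3 / ((1 - β₁ ^ 2 / β₂) * μ ^ 2 * √ζ)
      + 2 * β₁ ^ 2 * d * √ζ / (1 - β₁ ^ 2 / β₂)) ≤ ε ^ 2 / 3
  eta : η * (16 * L * d * √(d : ℝ) * (1 - β₁) / (1 - β₁ / √β₂) ^ 3) ≤ ε ^ 2 / 3
  steps : 3 / ε ^ 2 * (2 * (1 - β₁ / √β₂) * Δ / (η * (1 - β₁))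
      + 8 * C ^ 2 * d ^ 3 / ((1 - β₁ ^ 2 / β₂) * μ ^ 2 * √ζ)
      + 8 * L * η * √(d : ℝ) * (1 - β₁) / (1 - β₁ / √β₂) ^ 3 *
          ∑ i, Real.log ((β₂ ^ T * v₀ i + 4 * C ^ 2 * d ^ 2 / μ ^ 2) / v₀ i) / (1 - β₂))
    ≤ (T : ℝ)

end

/-!
The estimator `zoGrad` is an unbiased estimator of the gradient `H` of the smoothed objective `F_μ`
and, since `|f| ≤ C`, its norm is at most `G = 2 C d / μ`. Unbiasedness is the divergence theorem
on the unit ball (`integral_closedBall_lineDeriv`), obtained by integrating by parts against the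
cutoff `max (R² - ‖x‖²) 0 ^ 2`, passing to polar coordinates, and differentiating twice in `R`.

Put `r = β₁ / √β₂`. Since `vₜ₊₁ ≥ β₂ vₜ`, the scaled momentum `pₜ = mₜ / √(vₜ + ζ)` contracts with
ratio `r` up to the new gradient term, so the descent inequality for `F_μ` is applied at the
auxiliary points `zₜ = θₜ - (r / (1 - r)) η pₜ`, whose increments are
`-(η / (1 - r)) (pₜ₊₁ - r pₜ)`. Writing
`pₜ₊₁ - r pₜ = (1 - β₁) gₜ / (√β₂ √(vₜ + ζ)) - mₜ₊₁ κₜ` with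
`κₜ = 1 / (√β₂ √(vₜ + ζ)) - 1 / √(vₜ₊₁ + ζ) ≥ 0` makes the weight of `gₜ` a function of the past,
and the mismatches `κₜ` telescope (`MomentRun.sum_invScale_gap_le`). The second-order terms are
bounded by `∑ gₜ² / vₜ₊₁`, which telescopes to logarithms (`MomentRun.sum_sq_mul_invScale_le`).
All this holds pathwise (`AdaMMRun.sum_inner_le`); taking expectations and using that `gₜ` has
conditional mean `H(θₜ)` bounds `∑ₜ E ∑ᵢ Hᵢ(θₜ)² / √(vₜ,ᵢ + ζ)` by `ε² T` for admissible
parameters (`IsZOSampling.sum_integral_weightedGradSq_le`, `AdmissibleParams.sum_bound_le`).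

Finally `vₜ,ᵢ ≤ ‖v₀‖ + G²` turns this into the bound `(ζ^{1/4} + ‖v₀‖^{1/4} + √G) ε` on the
average of `E ‖H(θₜ)‖`, and `‖∇F - H‖ ≤ μ L √d`. The condition on `1 - β₂` in `AdmissibleParams`
is strong enough for the first term of `convBound` to dominate `√G ε`
(`AdmissibleParams.le_convBound`). The convergence statement with rates in `ε` reduces to the
explicit one, because small `c₂`, `c_η` and large `c_T` make the parameters admissible
(`exists_admissibleParams`). The limit of the ratio compares the leading terms, which are of
order `S^{1/4}`.
-/

noncomputable section

/-! ### Polar coordinates and the divergence theorem on a ball -/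

/-- The integral of `h (ρ u)` over the unit sphere, as a function of the radius `ρ`. -/
def sphereIntegral {d : ℕ} (h : Vec d → ℝ) (ρ : ℝ) : ℝ :=
  ∫ u, h (ρ • (u : Vec d)) ∂(volume : Measure (Vec d)).toSphere

lemma continuous_integral_sphere {d : ℕ} {g : ℝ → Metric.sphere (0 : Vec d) 1 → ℝ}
    (hg : Continuous (Function.uncurry g)) :
    Continuous fun ρ => ∫ u, g ρ u ∂(volume : Measure (Vec d)).toSphere := by
  have := continuous_parametric_integral_of_continuous
    (μ := (volume : Measure (Vec d)).toSphere) hg isCompact_univ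
  simpa only [setIntegral_univ] using this

lemma continuous_sphereIntegral {d : ℕ} {h : Vec d → ℝ} (hh : Continuous h) :
    Continuous (sphereIntegral h) :=
  continuous_integral_sphere (hh.comp (by fun_prop))

/-- Integration in polar coordinates. -/
lemma integral_eq_integral_sphere {d : ℕ} [NeZero d] {f : Vec d → ℝ} (hf : Integrable f) :
    ∫ x, f x = ∫ ρ in Set.Ioi (0 : ℝ), ρ ^ (d - 1) * sphereIntegral f ρ := by
  set V : Measure (Vec d) := volume
  have hfr : Module.finrank ℝ (Vec d) = d := finrank_euclideanSpace_fin
  have hmp := V.measurePreserving_homeomorphUnitSphereProd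
  have hemb := (homeomorphUnitSphereProd (Vec d)).measurableEmbedding
  let F : Metric.sphere (0 : Vec d) 1 × Set.Ioi (0 : ℝ) → ℝ := fun p => f (p.2.1 • p.1.1)
  have hF : ∀ x, F (homeomorphUnitSphereProd (Vec d) x) = f x.1 := by
    intro x
    simp only [F, homeomorphUnitSphereProd_apply_snd_coe, homeomorphUnitSphereProd_apply_fst_coe]
    rw [smul_smul, mul_inv_cancel₀ (norm_ne_zero_iff.2 x.2), one_smul]
  have h1 : ∫ x, f x ∂V = ∫ p, F p ∂(V.toSphere.prod (.volumeIoiPow (d - 1))) := by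
    rw [hfr] at hmp
    rw [← hmp.integral_comp hemb]
    simp only [hF]
    rw [integral_subtype_comap (measurableSet_singleton _).compl f, restrict_compl_singleton]
  have hFi : Integrable F (V.toSphere.prod (.volumeIoiPow (d - 1))) := by
    rw [hfr] at hmp
    rw [← hmp.integrable_comp_emb hemb]
    have : (F ∘ homeomorphUnitSphereProd (Vec d)) = f ∘ Subtype.val := funext hF
    rw [this, ← integrableOn_iff_comap_subtypeVal (measurableSet_singleton _).compl]
    exact hf.integrableOn
  rw [h1, integral_prod_symm _ hFi]
  simp only [Measure.volumeIoiPow, ENNReal.ofReal]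
  rw [integral_withDensity_eq_integral_smul]
  · rw [integral_subtype_comap measurableSet_Ioi (fun a : ℝ =>
      Real.toNNReal (a ^ (d - 1)) • ∫ u, f (a • u.1) ∂V.toSphere)]
    refine setIntegral_congr_fun measurableSet_Ioi fun x hx => ?_
    rw [NNReal.smul_def, Real.coe_toNNReal _ (pow_nonneg hx.out.le _), smul_eq_mul]
    rfl
  · exact (measurable_subtype_coe.pow_const _).real_toNNReal

lemma integral_closedBall_radial_mul {d : ℕ} [NeZero d] {h : Vec d → ℝ} (hh : Continuous h)
    {k : ℝ → ℝ} (hk : Continuous k) {R : ℝ} (hR : 0 ≤ R) :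
    ∫ x in Metric.closedBall (0 : Vec d) R, k ‖x‖ * h x =
      ∫ ρ in (0 : ℝ)..R, ρ ^ (d - 1) * (k ρ * sphereIntegral h ρ) := by
  have hint : IntegrableOn (fun x : Vec d => k ‖x‖ * h x) (Metric.closedBall 0 R) :=
    ((hk.comp continuous_norm).mul hh).continuousOn.integrableOn_compact
      (isCompact_closedBall _ _)
  rw [← integral_indicator measurableSet_closedBall, integral_eq_integral_sphere
    ((integrable_indicator_iff measurableSet_closedBall).2 hint),
    intervalIntegral.integral_of_le hR,
    setIntegral_eq_of_subset_of_forall_sdiff_eq_zero (s := Set.Ioc 0 R) measurableSet_Ioi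
      (fun x hx => hx.1)]
  · refine setIntegral_congr_fun measurableSet_Ioc fun ρ hρ => ?_
    simp only [sphereIntegral]
    congr 1
    rw [← integral_const_mul]
    congr 1 with u
    have hn : ‖ρ • (u : Vec d)‖ = ρ := by
      rw [norm_smul, norm_eq_of_mem_sphere, mul_one, Real.norm_of_nonneg hρ.1.le]
    rw [Set.indicator_of_mem (by simpa [mem_closedBall_zero_iff, hn] using hρ.2), hn]
  · intro ρ hρ
    have hρ0 : 0 < ρ := hρ.1
    have hρR : R < ρ := by
      by_contra hc
      exact hρ.2 ⟨hρ0, not_lt.1 hc⟩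
    simp only [sphereIntegral]
    rw [integral_eq_zero_of_ae, mul_zero]
    refine Eventually.of_forall fun u => ?_
    have hn : ‖ρ • (u : Vec d)‖ = ρ := by
      rw [norm_smul, norm_eq_of_mem_sphere, mul_one, Real.norm_of_nonneg hρ0.le]
    simp only [Pi.zero_apply]
    rw [Set.indicator_of_notMem (by simpa [mem_closedBall_zero_iff, hn] using hρR)]

lemma hasDerivAt_max_zero_sq (t : ℝ) :
    HasDerivAt (fun t : ℝ => max t 0 ^ 2) (2 * max t 0) t := by
  rcases lt_trichotomy t 0 with h | rfl | h
  · rw [max_eq_right h.le, mul_zero]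
    refine (hasDerivAt_const t (0 : ℝ)).congr_of_eventuallyEq ?_
    filter_upwards [gt_mem_nhds h] with x hx
    rw [max_eq_right hx.le]; norm_num
  · rw [hasDerivAt_iff_isLittleO]
    simp only [max_self, mul_zero, sub_zero, smul_zero, ne_eq, OfNat.ofNat_ne_zero,
      not_false_eq_true, zero_pow]
    refine Asymptotics.IsBigO.trans_isLittleO (g := fun x : ℝ => x ^ 2) ?_
      (Asymptotics.isLittleO_pow_id one_lt_two)
    refine Asymptotics.IsBigO.of_bound 1 (Eventually.of_forall fun x => ?_)
    rw [one_mul, Real.norm_of_nonneg (sq_nonneg _), Real.norm_of_nonneg (sq_nonneg _)]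
    rcases le_total x 0 with hx | hx
    · rw [max_eq_right hx]; simpa using sq_nonneg x
    · rw [max_eq_left hx]
  · rw [max_eq_left h.le]
    have : HasDerivAt (fun t : ℝ => t ^ 2) (2 * t) t := by simpa using hasDerivAt_pow 2 t
    refine this.congr_of_eventuallyEq ?_
    filter_upwards [lt_mem_nhds h] with x hx
    rw [max_eq_left hx.le]

/-- Integration by parts against the `C¹` cutoff `x ↦ max (R² - ‖x‖²) 0 ^ 2`. -/
lemma integral_closedBall_cutoff {d : ℕ} {φ φ' : Vec d → ℝ} {v : Vec d}
    (hφ : Continuous φ) (hφ' : Continuous φ') (hd : ∀ x, HasLineDerivAt ℝ φ (φ' x) x v)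
    {R : ℝ} (hR : 0 ≤ R) :
    ∫ x in Metric.closedBall (0 : Vec d) R, (R ^ 2 - ‖x‖ ^ 2) ^ 2 * φ' x =
      ∫ x in Metric.closedBall (0 : Vec d) R,
        (4 * (R ^ 2 - ‖x‖ ^ 2)) * (φ x * inner ℝ x v) := by
  let ψ : Vec d → ℝ := fun x => max (R ^ 2 - ‖x‖ ^ 2) 0 ^ 2
  let ψ' : Vec d → ℝ := fun x => 2 * max (R ^ 2 - ‖x‖ ^ 2) 0 * (-(2 * inner ℝ x v))
  have hψ : ∀ x, HasLineDerivAt ℝ ψ (ψ' x) x v := by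
    intro x
    have h1 : HasDerivAt (fun t : ℝ => x + t • v) v 0 := by
      simpa using ((hasDerivAt_id (0 : ℝ)).smul_const v).const_add x
    have h2 : HasDerivAt (fun t : ℝ => R ^ 2 - ‖x + t • v‖ ^ 2) (-(2 * inner ℝ x v)) 0 := by
      simpa using (h1.norm_sq).const_sub (R ^ 2)
    have := (hasDerivAt_max_zero_sq (R ^ 2 - ‖x + (0 : ℝ) • v‖ ^ 2)).comp (0 : ℝ) h2
    simpa [HasLineDerivAt, ψ, ψ', Function.comp_def] using this
  have hout : ∀ x, x ∉ Metric.closedBall (0 : Vec d) R → max (R ^ 2 - ‖x‖ ^ 2) 0 = 0 := by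
    intro x hx
    rw [mem_closedBall_zero_iff, not_le] at hx
    exact max_eq_right (by nlinarith)
  have hin : ∀ x, x ∈ Metric.closedBall (0 : Vec d) R →
      max (R ^ 2 - ‖x‖ ^ 2) 0 = R ^ 2 - ‖x‖ ^ 2 := by
    intro x hx
    rw [mem_closedBall_zero_iff] at hx
    exact max_eq_left (by nlinarith [norm_nonneg x])
  have hint : ∀ q : Vec d → ℝ, Continuous q → (∀ x, x ∉ Metric.closedBall (0 : Vec d) R → q x = 0) →
      Integrable q := fun q hq h0 =>
    hq.integrable_of_hasCompactSupport
      (HasCompactSupport.intro (isCompact_closedBall _ _) h0)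
  have hψc : Continuous ψ := by fun_prop
  have hψc' : Continuous ψ' := by fun_prop
  have key := integral_bilinear_hasLineDerivAt_right_eq_neg_left_of_integrable
    (μ := (volume : Measure (Vec d))) (f := ψ) (f' := ψ') (g := φ) (g' := φ') (v := v)
    (B := ContinuousLinearMap.mul ℝ ℝ)
    (hint _ (hψc'.mul hφ) (fun x hx => by simp [ψ', hout x hx]))
    (hint _ (hψc.mul hφ') (fun x hx => by simp [ψ, hout x hx]))
    (hint _ (hψc.mul hφ) (fun x hx => by simp [ψ, hout x hx]))
    (fun x _ => hψ x) (fun x _ => hd x)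
  simp only [ContinuousLinearMap.mul_apply'] at key
  rw [← setIntegral_eq_integral_of_forall_compl_eq_zero (s := Metric.closedBall (0 : Vec d) R)
    (fun x hx => by simp [ψ, hout x hx]), ← setIntegral_eq_integral_of_forall_compl_eq_zero
    (s := Metric.closedBall (0 : Vec d) R) (f := fun x => ψ' x * φ x)
    (fun x hx => by simp [ψ', hout x hx]), ← integral_neg] at key
  convert key using 1
  · exact setIntegral_congr_fun measurableSet_closedBall fun x hx => by simp only [ψ, hin x hx]
  · exact setIntegral_congr_fun measurableSet_closedBall fun x hx => by
      simp only [ψ', hin x hx]; ring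

/-- If two continuous densities satisfy the cutoff identities for all radii, then differentiating
twice in the radius removes the cutoff. -/
lemma integral_eq_of_cutoff {a b : ℝ → ℝ} (ha : Continuous a) (hb : Continuous b)
    (h : ∀ R : ℝ, 0 ≤ R → ∫ ρ in (0 : ℝ)..R, (R ^ 2 - ρ ^ 2) ^ 2 * a ρ =
      ∫ ρ in (0 : ℝ)..R, 4 * (R ^ 2 - ρ ^ 2) * ρ * b ρ) {R : ℝ} (hR : 0 < R) :
    ∫ ρ in (0 : ℝ)..R, a ρ = b R := by
  let I : ℕ → (ℝ → ℝ) → ℝ → ℝ := fun n q R => ∫ ρ in (0 : ℝ)..R, ρ ^ n * q ρ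
  have hI : ∀ n q, Continuous q → ∀ R, HasDerivAt (I n q) (R ^ n * q R) R := fun n q hq R =>
    intervalIntegral.integral_hasDerivAt_right
      (Continuous.intervalIntegrable (by fun_prop) _ _)
      (Continuous.stronglyMeasurableAtFilter (by fun_prop) _ _) (by fun_prop)
  have hii : ∀ n (q : ℝ → ℝ) R, Continuous q →
      IntervalIntegrable (fun ρ => ρ ^ n * q ρ) volume 0 R := fun n q R hq =>
    Continuous.intervalIntegrable (by fun_prop) _ _
  have e0 : ∀ R : ℝ, 0 < R → R ^ 4 * I 0 a R - 2 * R ^ 2 * I 2 a R + I 4 a R =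
      4 * R ^ 2 * I 1 b R - 4 * I 3 b R := by
    intro R hR
    have := h R hR.le
    have h1 : ∫ ρ in (0 : ℝ)..R, (R ^ 2 - ρ ^ 2) ^ 2 * a ρ =
        R ^ 4 * I 0 a R - 2 * R ^ 2 * I 2 a R + I 4 a R := by
      simp only [I]
      rw [← intervalIntegral.integral_const_mul, ← intervalIntegral.integral_const_mul,
        ← intervalIntegral.integral_sub ((hii _ _ _ ha).const_mul _) ((hii _ _ _ ha).const_mul _),
        ← intervalIntegral.integral_add
          (((hii _ _ _ ha).const_mul _).sub ((hii _ _ _ ha).const_mul _)) (hii _ _ _ ha)]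
      congr 1 with ρ; ring
    have h2 : ∫ ρ in (0 : ℝ)..R, 4 * (R ^ 2 - ρ ^ 2) * ρ * b ρ =
        4 * R ^ 2 * I 1 b R - 4 * I 3 b R := by
      simp only [I]
      rw [← intervalIntegral.integral_const_mul, ← intervalIntegral.integral_const_mul,
        ← intervalIntegral.integral_sub ((hii _ _ _ hb).const_mul _) ((hii _ _ _ hb).const_mul _)]
      congr 1 with ρ; ring
    rw [← h1, ← h2, this]
  have uniq : ∀ {p q : ℝ → ℝ} {p' q' R : ℝ}, 0 < R → (∀ R, 0 < R → p R = q R) →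
      HasDerivAt p p' R → HasDerivAt q q' R → p' = q' := by
    intro p q p' q' R hR hpq hp hq
    refine hp.unique (hq.congr_of_eventuallyEq ?_)
    filter_upwards [lt_mem_nhds hR] with x hx using hpq x hx
  have e1 : ∀ R : ℝ, 0 < R → R ^ 2 * I 0 a R - I 2 a R = 2 * I 1 b R := by
    intro R hR
    have := uniq hR e0
      ((((hasDerivAt_pow 4 R).mul (hI 0 a ha R)).sub
        (((hasDerivAt_pow 2 R).const_mul 2).mul (hI 2 a ha R))).add (hI 4 a ha R))
      ((((hasDerivAt_pow 2 R).const_mul 4).mul (hI 1 b hb R)).sub ((hI 3 b hb R).const_mul 4))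
    have h4 : 4 * R * (R ^ 2 * I 0 a R - I 2 a R) = 4 * R * (2 * I 1 b R) := by
      norm_num at this; linarith
    exact mul_left_cancel₀ (by positivity) h4
  have := uniq hR e1 (((hasDerivAt_pow 2 R).mul (hI 0 a ha R)).sub (hI 2 a ha R))
    ((hI 1 b hb R).const_mul 2)
  have h4 : 2 * R * I 0 a R = 2 * R * b R := by norm_num at this; linarith
  simpa [I] using mul_left_cancel₀ (by positivity) h4

/-- The divergence theorem on the unit ball for the vector field `φ v` with constant `v`. -/
theorem integral_closedBall_lineDeriv {d : ℕ} [NeZero d] {φ φ' : Vec d → ℝ} {v : Vec d}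
    (hφ : Continuous φ) (hφ' : Continuous φ') (hd : ∀ x, HasLineDerivAt ℝ φ (φ' x) x v) :
    ∫ x in Metric.closedBall (0 : Vec d) 1, φ' x =
      ∫ u, φ (u : Vec d) * inner ℝ (u : Vec d) v ∂(volume : Measure (Vec d)).toSphere := by
  have hφv : Continuous fun x : Vec d => φ x * inner ℝ x v := by fun_prop
  have hB : ∀ ρ, sphereIntegral (fun x : Vec d => φ x * inner ℝ x v) ρ =
      ρ * ∫ u, φ (ρ • (u : Vec d)) * inner ℝ (u : Vec d) v
        ∂(volume : Measure (Vec d)).toSphere := by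
    intro ρ
    rw [sphereIntegral, ← integral_const_mul]
    congr 1 with u
    rw [real_inner_smul_left]; ring
  have hBc : Continuous fun ρ : ℝ => ∫ u, φ (ρ • (u : Vec d)) * inner ℝ (u : Vec d) v
      ∂(volume : Measure (Vec d)).toSphere :=
    continuous_integral_sphere ((hφ.comp (by fun_prop)).mul (by fun_prop))
  have hA := continuous_sphereIntegral hφ'
  have key := integral_eq_of_cutoff (a := fun ρ => ρ ^ (d - 1) * sphereIntegral φ' ρ)
    (b := fun ρ => ρ ^ (d - 1) * ∫ u, φ (ρ • (u : Vec d)) * inner ℝ (u : Vec d) v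
      ∂(volume : Measure (Vec d)).toSphere) (by fun_prop) (by fun_prop) (fun R hR => by
      have h1 := integral_closedBall_radial_mul hφ' (k := fun ρ => (R ^ 2 - ρ ^ 2) ^ 2)
        (by fun_prop) hR
      have h2 := integral_closedBall_radial_mul hφv (k := fun ρ => 4 * (R ^ 2 - ρ ^ 2))
        (by fun_prop) hR
      have h3 := integral_closedBall_cutoff hφ hφ' hd hR
      rw [h1, h2] at h3
      convert h3 using 2
      · ext ρ; ring
      · ext ρ; rw [hB]; ring) one_pos
  have h5 := integral_closedBall_radial_mul hφ' (k := fun _ => 1) continuous_const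
    (zero_le_one (α := ℝ))
  simp only [one_mul] at h5
  rw [h5, key]
  simp

/-! ### The uniform distributions on the sphere and on the ball -/

instance {d : ℕ} [NeZero d] : IsProbabilityMeasure (sphereUniform d) := by
  have h0 : (volume : Measure (Vec d)).toSphere ≠ 0 := by
    rw [Ne, Measure.toSphere_eq_zero_iff_finrank, finrank_euclideanSpace_fin]
    exact NeZero.ne d
  have : NeZero (volume : Measure (Vec d)).toSphere := ⟨h0⟩
  exact Measure.isProbabilityMeasure_map measurable_subtype_coe.aemeasurable

instance {d : ℕ} : IsProbabilityMeasure (ballUniform d) :=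
  cond_isProbabilityMeasure_of_finite
    (Metric.measure_closedBall_pos _ _ one_pos).ne' measure_closedBall_lt_top.ne

lemma ae_sphereUniform_norm_eq_one (d : ℕ) : ∀ᵐ u ∂sphereUniform d, ‖u‖ = 1 := by
  rw [sphereUniform, ae_map_iff measurable_subtype_coe.aemeasurable
    (measurableSet_eq_fun (by fun_prop) (by fun_prop))]
  exact Eventually.of_forall fun u => norm_eq_of_mem_sphere u

lemma ae_ballUniform_norm_le_one (d : ℕ) : ∀ᵐ w ∂ballUniform d, ‖w‖ ≤ 1 := by
  filter_upwards [ae_cond_mem (μ := (volume : Measure (Vec d)))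
    (s := Metric.closedBall (0 : Vec d) 1) measurableSet_closedBall] with w hw
  simpa using hw

lemma Continuous.integrable_ballUniform {d : ℕ} {q : Vec d → ℝ} (hq : Continuous q) :
    Integrable q (ballUniform d) := by
  have h : IntegrableOn q (Metric.closedBall (0 : Vec d) 1) :=
    hq.continuousOn.integrableOn_compact (isCompact_closedBall _ _)
  exact h.smul_measure
    (ENNReal.inv_ne_top.2 (Metric.measure_closedBall_pos _ _ one_pos).ne')

lemma integral_ballUniform {d : ℕ} (q : Vec d → ℝ) :
    ∫ w, q w ∂ballUniform d = (volume.real (Metric.closedBall (0 : Vec d) 1))⁻¹ *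
      ∫ w in Metric.closedBall (0 : Vec d) 1, q w := by
  rw [ballUniform, ProbabilityTheory.cond, integral_smul_measure, ENNReal.toReal_inv, smul_eq_mul]
  rfl

lemma integral_sphereUniform {d : ℕ} {q : Vec d → ℝ} (hq : Measurable q) :
    ∫ u, q u ∂sphereUniform d = (d * volume.real (Metric.closedBall (0 : Vec d) 1))⁻¹ *
      ∫ u, q (u : Vec d) ∂(volume : Measure (Vec d)).toSphere := by
  rw [sphereUniform, integral_map measurable_subtype_coe.aemeasurable hq.aestronglyMeasurable,
    integral_smul_measure, ENNReal.toReal_inv, smul_eq_mul, ← measureReal_def,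
    Measure.toSphere_real_apply_univ, finrank_euclideanSpace_fin, measureReal_def,
    measureReal_def, Measure.addHaar_unitClosedBall_eq_addHaar_unitBall]

lemma sum_abs_le_sqrt_mul_norm {d : ℕ} (x : Vec d) : ∑ i, |x i| ≤ √d * ‖x‖ := by
  rw [EuclideanSpace.norm_eq, ← Real.sqrt_mul (Nat.cast_nonneg d)]
  refine Real.le_sqrt_of_sq_le ?_
  have := sq_sum_le_card_mul_sum_sq (s := Finset.univ) (f := fun i => |x i|)
  simpa using this

lemma abs_coord_le_norm {d : ℕ} (x : Vec d) (i : Fin d) : |x i| ≤ ‖x‖ := by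
  simpa using PiLp.norm_apply_le x i

lemma norm_le_sqrt_mul_of_abs_le {d : ℕ} {x : Vec d} {c : ℝ} (hc : 0 ≤ c)
    (h : ∀ i, |x i| ≤ c) : ‖x‖ ≤ √d * c := by
  rw [EuclideanSpace.norm_eq, ← Real.sqrt_sq hc, ← Real.sqrt_mul (Nat.cast_nonneg d)]
  refine Real.sqrt_le_sqrt ?_
  calc ∑ i, ‖x i‖ ^ 2 ≤ ∑ _i : Fin d, c ^ 2 := by
        refine Finset.sum_le_sum fun i _ => ?_
        rw [Real.norm_eq_abs]
        exact pow_le_pow_left₀ (abs_nonneg _) (h i) 2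
    _ = d * c ^ 2 := by simp

/-! ### Functions with coordinatewise Lipschitz gradient and their randomized smoothing -/

/-- `F` is differentiable and each partial derivative is `L`-Lipschitz. -/
structure PartialsLipschitz {d : ℕ} (F : Vec d → ℝ) (L : ℝ) : Prop where
  differentiable : Differentiable ℝ F
  lipschitz : ∀ θ θ' : Vec d, ∀ i : Fin d, |gradient F θ i - gradient F θ' i| ≤ L * ‖θ - θ'‖

/-- The `i`-th coordinate of the gradient of the smoothed function:
`E_w[∂ᵢF(θ + μ w)]` with `w` uniform on the unit ball. -/
def smoothedPartial {d : ℕ} (F : Vec d → ℝ) (μ : ℝ) (θ : Vec d) (i : Fin d) : ℝ :=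
  ∫ w, gradient F (θ + μ • w) i ∂ballUniform d

namespace PartialsLipschitz

variable {d : ℕ} {F : Vec d → ℝ} {L : ℝ}

lemma continuous_partial (hF : PartialsLipschitz F L) (i : Fin d) :
    Continuous fun θ => gradient F θ i := by
  refine (LipschitzWith.of_dist_le_mul (K := L.toNNReal) fun x y => ?_).continuous
  rw [Real.dist_eq, dist_eq_norm]
  exact (hF.lipschitz x y i).trans (by gcongr; exact Real.le_coe_toNNReal L)

lemma continuous_gradient (hF : PartialsLipschitz F L) : Continuous (gradient F) := by
  have : Continuous fun θ => WithLp.toLp 2 fun i => gradient F θ i :=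
    (PiLp.continuous_toLp 2 _).comp (continuous_pi hF.continuous_partial)
  exact this

lemma nonneg [NeZero d] (hF : PartialsLipschitz F L) : 0 ≤ L := by
  have := (abs_nonneg _).trans (hF.lipschitz (EuclideanSpace.single 0 1) 0 0)
  simpa using this

lemma hasDerivAt_line (hF : PartialsLipschitz F L) (x δ : Vec d) (t : ℝ) :
    HasDerivAt (fun t : ℝ => F (x + t • δ)) (∑ i, gradient F (x + t • δ) i * δ i) t := by
  have h1 : HasDerivAt (fun t : ℝ => x + t • δ) δ t := by
    simpa using ((hasDerivAt_id t).smul_const δ).const_add x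
  have h2 := (hF.differentiable (x + t • δ)).hasGradientAt.hasFDerivAt.comp_hasDerivAt t h1
  refine h2.congr_deriv ?_
  rw [InnerProductSpace.toDual_apply_apply, PiLp.inner_apply]
  simp [mul_comm]

lemma le_taylor (hF : PartialsLipschitz F L) (x y : Vec d) :
    F y ≤ F x + ∑ i, gradient F x i * (y - x) i + L * √d / 2 * ‖y - x‖ ^ 2 := by
  set δ := y - x with hδ
  set c := ∑ i, gradient F x i * δ i
  set M := L * √d * ‖δ‖ ^ 2
  have hd : ∀ t : ℝ, HasDerivAt (fun t : ℝ => F (x + t • δ) - (c * t + M / 2 * t ^ 2))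
      ((∑ i, gradient F (x + t • δ) i * δ i) - (c + M * t)) t := fun t =>
    ((hF.hasDerivAt_line x δ t).sub (((hasDerivAt_id t).const_mul c).add
      ((hasDerivAt_pow 2 t).const_mul (M / 2)))).congr_deriv (by simp; ring)
  have hanti : AntitoneOn (fun t : ℝ => F (x + t • δ) - (c * t + M / 2 * t ^ 2))
      (Set.Icc 0 1) := by
    refine antitoneOn_of_deriv_nonpos (convex_Icc 0 1)
      (fun t _ => (hd t).continuousAt.continuousWithinAt)
      (fun t _ => (hd t).differentiableAt.differentiableWithinAt) fun t ht => ?_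
    rw [interior_Icc] at ht
    rw [(hd t).deriv]
    have h1 : ∑ i, gradient F (x + t • δ) i * δ i - c ≤ L * (t * ‖δ‖) * ∑ i, |δ i| := by
      rw [← Finset.sum_sub_distrib, Finset.mul_sum]
      refine Finset.sum_le_sum fun i _ => ?_
      rw [← sub_mul]
      refine (le_abs_self _).trans ?_
      rw [abs_mul]
      refine mul_le_mul_of_nonneg_right ?_ (abs_nonneg _)
      simpa [norm_smul, abs_of_pos ht.1] using hF.lipschitz (x + t • δ) x i
    rcases Nat.eq_zero_or_pos d with rfl | hdpos
    · simp [M, c]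
    have : NeZero d := ⟨hdpos.ne'⟩
    have h2 : L * (t * ‖δ‖) * ∑ i, |δ i| ≤ L * (t * ‖δ‖) * (√d * ‖δ‖) :=
      mul_le_mul_of_nonneg_left (sum_abs_le_sqrt_mul_norm δ)
        (mul_nonneg hF.nonneg (mul_nonneg ht.1.le (norm_nonneg _)))
    have h3 : L * (t * ‖δ‖) * (√d * ‖δ‖) = M * t := by simp only [M]; ring
    linarith
  have := hanti (Set.left_mem_Icc.2 zero_le_one) (Set.right_mem_Icc.2 zero_le_one) zero_le_one
  simp only [one_smul, zero_smul, add_zero, mul_one, mul_zero, one_pow] at this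
  have hy : x + δ = y := by simp [hδ]
  rw [hy] at this
  simp only [M] at this
  norm_num at this
  linarith

lemma smoothed_le_taylor (hF : PartialsLipschitz F L) (μ : ℝ) (x y : Vec d) :
    smoothed F μ y ≤ smoothed F μ x + ∑ i, smoothedPartial F μ x i * (y - x) i
      + L * √d / 2 * ‖y - x‖ ^ 2 := by
  have hFc := hF.differentiable.continuous
  have hx : Integrable (fun w => F (x + μ • w)) (ballUniform d) :=
    Continuous.integrable_ballUniform (by fun_prop)
  have hy : Integrable (fun w => F (y + μ • w)) (ballUniform d) :=
    Continuous.integrable_ballUniform (by fun_prop)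
  have hg : ∀ i, Integrable (fun w => gradient F (x + μ • w) i * (y - x) i) (ballUniform d) :=
    fun i => Continuous.integrable_ballUniform
      (((hF.continuous_partial i).comp (by fun_prop)).mul continuous_const)
  have h1 : smoothed F μ y ≤ ∫ w, F (x + μ • w) + ∑ i, gradient F (x + μ • w) i * (y - x) i
      + L * √d / 2 * ‖y - x‖ ^ 2 ∂ballUniform d := by
    refine integral_mono hy ((hx.add (integrable_finsetSum _ fun i _ => hg i)).add
      (integrable_const _)) fun w => ?_
    simpa using hF.le_taylor (x + μ • w) (y + μ • w)
  rw [integral_add (f := fun w => F (x + μ • w) + ∑ i, gradient F (x + μ • w) i * (y - x) i)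
      (hx.add (integrable_finsetSum _ fun i _ => hg i)) (integrable_const _),
    integral_add hx (integrable_finsetSum _ fun i _ => hg i),
    integral_finsetSum _ fun i _ => hg i] at h1
  simp only [integral_mul_const, integral_const, probReal_univ, one_smul] at h1
  exact h1

lemma integrable_partial_ball (hF : PartialsLipschitz F L) (μ : ℝ) (x : Vec d) (i : Fin d) :
    Integrable (fun w => gradient F (x + μ • w) i) (ballUniform d) :=
  Continuous.integrable_ballUniform ((hF.continuous_partial i).comp (by fun_prop))

lemma abs_smoothedPartial_sub_le (hF : PartialsLipschitz F L) (μ : ℝ) (x y : Vec d) (i : Fin d) :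
    |smoothedPartial F μ x i - smoothedPartial F μ y i| ≤ L * ‖x - y‖ := by
  rw [smoothedPartial, smoothedPartial, ← integral_sub (hF.integrable_partial_ball μ x i)
    (hF.integrable_partial_ball μ y i), ← Real.norm_eq_abs]
  have := norm_integral_le_of_norm_le_const (μ := ballUniform d) (C := L * ‖x - y‖)
    (f := fun w => gradient F (x + μ • w) i - gradient F (y + μ • w) i)
    (Eventually.of_forall fun w => by simpa using hF.lipschitz (x + μ • w) (y + μ • w) i)
  simpa using this

lemma abs_smoothedPartial_sub_partial_le [NeZero d] (hF : PartialsLipschitz F L) {μ : ℝ}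
    (hμ : 0 ≤ μ) (x : Vec d) (i : Fin d) :
    |gradient F x i - smoothedPartial F μ x i| ≤ μ * L := by
  have h0 : gradient F x i = ∫ _w, gradient F x i ∂ballUniform d := by simp
  rw [smoothedPartial, h0, ← integral_sub (integrable_const _)
    (hF.integrable_partial_ball μ x i), ← Real.norm_eq_abs]
  have := norm_integral_le_of_norm_le_const (μ := ballUniform d) (C := μ * L)
    (f := fun w => gradient F x i - gradient F (x + μ • w) i) (by
      filter_upwards [ae_ballUniform_norm_le_one d] with w hw
      have h := hF.lipschitz x (x + μ • w) i
      simp only [sub_add_cancel_left, norm_neg, norm_smul, Real.norm_of_nonneg hμ] at h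
      rw [Real.norm_eq_abs]
      refine h.trans ?_
      have h1 := hF.nonneg
      nlinarith [mul_le_mul_of_nonneg_left hw (mul_nonneg h1 hμ)])
  simpa using this

/-- The gradient of the smoothed function is the mean of the two-point estimator: the divergence
theorem on the ball applied to `w ↦ F(θ + μ w) - F(θ)`. -/
lemma integral_sphereUniform_two_point [NeZero d] (hF : PartialsLipschitz F L) {μ : ℝ}
    (hμ : 0 < μ) (θ : Vec d) (i : Fin d) :
    ∫ u, (F (θ + μ • u) - F θ) / μ * u i ∂sphereUniform d = smoothedPartial F μ θ i / d := by
  have hFc := hF.differentiable.continuous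
  have hg := hF.continuous_partial i
  have hdiv := integral_closedBall_lineDeriv (v := EuclideanSpace.single i (1 : ℝ))
    (φ := fun w => (F (θ + μ • w) - F θ) / μ) (φ' := fun w => gradient F (θ + μ • w) i)
    (by fun_prop) (hg.comp (by fun_prop)) (fun w => by
      have h := ((hF.hasDerivAt_line (θ + μ • w) (μ • EuclideanSpace.single i (1 : ℝ)) 0).sub_const
        (F θ)).div_const μ
      have he : (fun t : ℝ => (F (θ + μ • (w + t • EuclideanSpace.single i (1 : ℝ))) - F θ) / μ) =
          fun t : ℝ =>
            (F (θ + μ • w + t • (μ • EuclideanSpace.single i (1 : ℝ))) - F θ) / μ := by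
        ext t
        rw [smul_add, smul_comm μ t, add_assoc]
      rw [HasLineDerivAt, he]
      refine h.congr_deriv ?_
      simp [hμ.ne'])
  rw [integral_sphereUniform (by fun_prop), smoothedPartial, integral_ballUniform, hdiv]
  have : ∀ u : Vec d, inner ℝ u (EuclideanSpace.single i (1 : ℝ)) = u i := fun u => by
    simp [EuclideanSpace.inner_single_right]
  simp only [this]
  rw [mul_inv]; ring

lemma abs_smoothedPartial_le [NeZero d] (hF : PartialsLipschitz F L) {μ C : ℝ} (hμ : 0 < μ)
    (hC : ∀ θ, |F θ| ≤ C) (θ : Vec d) (i : Fin d) :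
    |smoothedPartial F μ θ i| ≤ 2 * C * d / μ := by
  have hd : (0 : ℝ) < d := Nat.cast_pos.2 (NeZero.pos d)
  have h := norm_integral_le_of_norm_le_const (μ := sphereUniform d) (C := 2 * C / μ)
    (f := fun u => (F (θ + μ • u) - F θ) / μ * u i) (by
      filter_upwards [ae_sphereUniform_norm_eq_one d] with u hu
      rw [Real.norm_eq_abs, abs_mul, abs_div, abs_of_pos hμ]
      have h1 : |u i| ≤ 1 := (abs_coord_le_norm u i).trans hu.le
      have h2 : |F (θ + μ • u) - F θ| ≤ 2 * C :=
        (abs_sub _ _).trans (by linarith [hC (θ + μ • u), hC θ])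
      have h3 : |F (θ + μ • u) - F θ| / μ ≤ 2 * C / μ := by gcongr
      calc _ ≤ |F (θ + μ • u) - F θ| / μ * 1 := by gcongr
        _ ≤ _ := by rwa [mul_one])
  rw [hF.integral_sphereUniform_two_point hμ, Real.norm_eq_abs, abs_div, abs_of_pos hd,
    probReal_univ, mul_one, div_le_iff₀ hd] at h
  calc _ ≤ _ := h
    _ = _ := by ring

end PartialsLipschitz

lemma abs_smoothed_le {d : ℕ} {F : Vec d → ℝ} {C : ℝ} (hC : ∀ θ, |F θ| ≤ C) (μ : ℝ) (θ : Vec d) :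
    |smoothed F μ θ| ≤ C := by
  have h := norm_integral_le_of_norm_le_const (μ := ballUniform d) (C := C)
    (f := fun w => F (θ + μ • w)) (Eventually.of_forall fun w => hC _)
  simpa [smoothed] using h

/-! ### One coordinate of the ZO-AdaMM recursion -/

/-- The coordinatewise step scaling `1 / √(v + ζ)`. -/
def invScale (ζ v : ℝ) : ℝ := 1 / √(v + ζ)

/-- The moment recursions of one coordinate, driven by gradient estimates `g` bounded by `G`. -/
structure MomentRun (β₁ β₂ G : ℝ) (m v g : ℕ → ℝ) : Prop where
  m_zero : m 0 = 0
  v_zero : 0 < v 0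
  m_succ : ∀ t, m (t + 1) = β₁ * m t + (1 - β₁) * g t
  v_succ : ∀ t, v (t + 1) = β₂ * v t + (1 - β₂) * g t ^ 2
  bound : ∀ t, |g t| ≤ G

namespace MomentRun

variable {β₁ β₂ G ζ : ℝ} {m v g : ℕ → ℝ}

lemma v_pos (h : MomentRun β₁ β₂ G m v g) (hb : 0 < β₂) (hb1 : β₂ < 1) (t : ℕ) : 0 < v t := by
  induction t with
  | zero => exact h.v_zero
  | succ t ih =>
    rw [h.v_succ]
    have := mul_pos hb ih
    have := mul_nonneg (sub_nonneg.2 hb1.le) (sq_nonneg (g t))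
    linarith

lemma v_le (h : MomentRun β₁ β₂ G m v g) (hb : 0 < β₂) (hb1 : β₂ < 1) (t : ℕ) :
    v t ≤ β₂ ^ t * v 0 + G ^ 2 := by
  induction t with
  | zero => simp [sq_nonneg]
  | succ t ih =>
    rw [h.v_succ, pow_succ β₂ t]
    have h1 : g t ^ 2 ≤ G ^ 2 := sq_le_sq' (abs_le.1 (h.bound t)).1 (abs_le.1 (h.bound t)).2
    nlinarith [mul_le_mul_of_nonneg_left ih hb.le,
      mul_le_mul_of_nonneg_left h1 (sub_nonneg.2 hb1.le)]

lemma abs_m_le (h : MomentRun β₁ β₂ G m v g) (hβ : 0 < β₁) (hβ1 : β₁ < 1) (t : ℕ) :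
    |m t| ≤ G := by
  induction t with
  | zero => rw [h.m_zero, abs_zero]; exact (abs_nonneg _).trans (h.bound 0)
  | succ t ih =>
    rw [h.m_succ]
    refine (abs_add_le _ _).trans ?_
    rw [abs_mul, abs_mul, abs_of_pos hβ, abs_of_pos (sub_pos.2 hβ1)]
    nlinarith [mul_le_mul_of_nonneg_left ih hβ.le,
      mul_le_mul_of_nonneg_left (h.bound t) (sub_pos.2 hβ1).le]

lemma invScale_pos (h : MomentRun β₁ β₂ G m v g) (hb : 0 < β₂) (hb1 : β₂ < 1) (hζ : 0 < ζ)
    (t : ℕ) : 0 < invScale ζ (v t) := by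
  have := h.v_pos hb hb1 t
  unfold invScale; positivity

lemma invScale_le (h : MomentRun β₁ β₂ G m v g) (hb : 0 < β₂) (hb1 : β₂ < 1) (hζ : 0 < ζ)
    (t : ℕ) : invScale ζ (v t) ≤ 1 / √ζ := by
  have := h.v_pos hb hb1 t
  unfold invScale; gcongr; linarith

lemma invScale_succ_le (h : MomentRun β₁ β₂ G m v g) (hb : 0 < β₂) (hb1 : β₂ < 1) (hζ : 0 < ζ)
    (t : ℕ) : invScale ζ (v (t + 1)) ≤ invScale ζ (v t) / √β₂ := by
  have hv := h.v_pos hb hb1 t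
  unfold invScale
  rw [div_div, ← Real.sqrt_mul (by positivity)]
  refine one_div_le_one_div_of_le (Real.sqrt_pos.2 (by positivity)) (Real.sqrt_le_sqrt ?_)
  rw [h.v_succ]
  nlinarith [mul_nonneg (sub_nonneg.2 hb1.le) (sq_nonneg (g t))]

/-- The differences between the predictable scaling `1 / (√β₂ √(vₜ + ζ))` and the actual scaling
`1 / √(vₜ₊₁ + ζ)` telescope, up to an error of order `1 - β₂` per step. -/
lemma sum_invScale_gap_le (h : MomentRun β₁ β₂ G m v g) (hb : 1 / 2 ≤ β₂) (hb1 : β₂ < 1)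
    (hζ : 0 < ζ) (T : ℕ) :
    ∑ t ∈ Finset.range T, (invScale ζ (v t) / √β₂ - invScale ζ (v (t + 1))) ≤
      (1 + T * (1 - β₂)) / √ζ := by
  have hb0 : 0 < β₂ := by linarith
  have hs : 0 < √β₂ := Real.sqrt_pos.2 hb0
  have hsq : √β₂ ^ 2 = β₂ := Real.sq_sqrt hb0.le
  have hs1 : √β₂ < 1 := by nlinarith
  have hs2 : 7 / 10 ≤ √β₂ := by nlinarith
  -- `1 / √β₂ - 1 = (1 - β₂) / (√β₂ + β₂)` and the denominator exceeds one.
  have hc : 1 / √β₂ - 1 ≤ 1 - β₂ := by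
    rw [div_sub_one hs.ne', div_le_iff₀ hs]
    nlinarith
  have h1 : ∀ t, invScale ζ (v t) / √β₂ - invScale ζ (v (t + 1)) ≤
      (invScale ζ (v t) - invScale ζ (v (t + 1))) + (1 - β₂) / √ζ := fun t => by
    have h2 := (h.invScale_pos hb0 hb1 hζ t).le
    have h3 := h.invScale_le hb0 hb1 hζ t
    have h4 : invScale ζ (v t) / √β₂ = invScale ζ (v t) + (1 / √β₂ - 1) * invScale ζ (v t) := by
      ring
    have h5 : (1 / √β₂ - 1) * invScale ζ (v t) ≤ (1 - β₂) * (1 / √ζ) := by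
      gcongr
    rw [h4]
    have : (1 - β₂) / √ζ = (1 - β₂) * (1 / √ζ) := by ring
    linarith
  refine (Finset.sum_le_sum fun t _ => h1 t).trans ?_
  rw [Finset.sum_add_distrib, Finset.sum_range_sub' (fun t => invScale ζ (v t))]
  have h2 := (h.invScale_pos hb0 hb1 hζ T).le
  have h3 := h.invScale_le hb0 hb1 hζ 0
  simp only [Finset.sum_const, Finset.card_range, nsmul_eq_mul]
  have : (1 + T * (1 - β₂)) / √ζ = 1 / √ζ + T * ((1 - β₂) / √ζ) := by ring
  linarith

/-- The normalized squared gradients sum to a telescoping logarithm: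
`(1 - β₂) gₜ² / vₜ₊₁ = 1 - β₂ vₜ / vₜ₊₁ ≤ log (vₜ₊₁ / (β₂ vₜ))`. -/
lemma sum_sq_mul_invScale_le (h : MomentRun β₁ β₂ G m v g) (hb : 1 / 2 ≤ β₂) (hb1 : β₂ < 1)
    (hζ : 0 < ζ) (T : ℕ) :
    ∑ t ∈ Finset.range T, (g t * invScale ζ (v (t + 1))) ^ 2 ≤
      Real.log ((β₂ ^ T * v 0 + G ^ 2) / v 0) / (1 - β₂) + 2 * T := by
  have hb0 : 0 < β₂ := by linarith
  have h1b : 0 < 1 - β₂ := by linarith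
  have hlogb : -Real.log β₂ ≤ 2 * (1 - β₂) := by
    have h1 := Real.log_le_sub_one_of_pos (inv_pos.2 hb0)
    rw [Real.log_inv] at h1
    refine h1.trans ?_
    rw [inv_eq_one_div, div_sub_one hb0.ne', div_le_iff₀ hb0]
    nlinarith
  have h1 : ∀ t, (1 - β₂) * (g t * invScale ζ (v (t + 1))) ^ 2 ≤
      (Real.log (v (t + 1)) - Real.log (v t)) + 2 * (1 - β₂) := fun t => by
    have hv := h.v_pos hb0 hb1 t
    have hv' := h.v_pos hb0 hb1 (t + 1)
    have h2 : (g t * invScale ζ (v (t + 1))) ^ 2 ≤ g t ^ 2 / v (t + 1) := by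
      rw [invScale, mul_pow, div_pow, Real.sq_sqrt (by positivity), one_pow, mul_one_div]
      gcongr
      linarith
    have h3 : (1 - β₂) * (g t ^ 2 / v (t + 1)) = 1 - β₂ * v t / v (t + 1) := by
      field_simp
      linarith [h.v_succ t]
    have h4 := Real.log_le_sub_one_of_pos (x := β₂ * v t / v (t + 1)) (by positivity)
    rw [Real.log_div (by positivity) hv'.ne', Real.log_mul hb0.ne' hv.ne'] at h4
    have := mul_le_mul_of_nonneg_left h2 h1b.le
    linarith
  have h5 := Finset.sum_le_sum fun t (_ : t ∈ Finset.range T) => h1 t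
  rw [← Finset.mul_sum, Finset.sum_add_distrib,
    Finset.sum_range_sub (fun t => Real.log (v t))] at h5
  simp only [Finset.sum_const, Finset.card_range, nsmul_eq_mul] at h5
  have h6 : Real.log (v T) - Real.log (v 0) ≤ Real.log ((β₂ ^ T * v 0 + G ^ 2) / v 0) := by
    rw [← Real.log_div (h.v_pos hb0 hb1 T).ne' h.v_zero.ne']
    have := h.v_pos hb0 hb1 T
    have := h.v_zero
    refine Real.log_le_log (by positivity) ?_
    gcongr
    exact h.v_le hb0 hb1 T
  rw [div_add' _ _ _ h1b.ne', le_div_iff₀ h1b]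
  linarith

/-- The scaled momenta satisfy a contraction with ratio `r = β₁ / √β₂`. -/
lemma sum_sq_scaled_momentum_le (h : MomentRun β₁ β₂ G m v g) (hβ : 0 < β₁) (hβ1 : β₁ < 1)
    (hb : 0 < β₂) (hb1 : β₂ < 1) (hr : β₁ < √β₂) (hζ : 0 < ζ) (T : ℕ) :
    ∑ t ∈ Finset.range T, (m (t + 1) * invScale ζ (v (t + 1))) ^ 2 ≤
      (1 - β₁) ^ 2 / (1 - β₁ / √β₂) ^ 2 *
        ∑ t ∈ Finset.range T, (g t * invScale ζ (v (t + 1))) ^ 2 := by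
  have hs : 0 < √β₂ := Real.sqrt_pos.2 hb
  set r := β₁ / √β₂ with hr_def
  have hr0 : 0 < r := div_pos hβ hs
  have hr1 : 0 < 1 - r := sub_pos.2 ((div_lt_one hs).2 hr)
  set p : ℕ → ℝ := fun t => m t * invScale ζ (v t)
  set c : ℕ → ℝ := fun t => g t * invScale ζ (v (t + 1))
  have hstep : ∀ t, p (t + 1) ^ 2 ≤ r * p t ^ 2 + (1 - β₁) ^ 2 / (1 - r) * c t ^ 2 := fun t => by
    have hs1 := (h.invScale_pos hb hb1 hζ (t + 1)).le
    have hs0 := (h.invScale_pos hb hb1 hζ t).le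
    have h1 : |p (t + 1)| ≤ r * |p t| + (1 - β₁) * |c t| := by
      have h2 : p (t + 1) = β₁ * (m t * invScale ζ (v (t + 1))) + (1 - β₁) * c t := by
        simp only [p, c, h.m_succ]; ring
      have h3 : β₁ * |m t * invScale ζ (v (t + 1))| ≤ r * |p t| := by
        simp only [p]
        rw [abs_mul, abs_mul, abs_of_nonneg hs0, abs_of_nonneg hs1]
        calc β₁ * (|m t| * invScale ζ (v (t + 1)))
            ≤ β₁ * (|m t| * (invScale ζ (v t) / √β₂)) := by
              gcongr; exact h.invScale_succ_le hb hb1 hζ t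
          _ = r * (|m t| * invScale ζ (v t)) := by rw [hr_def]; ring
      rw [h2]
      refine (abs_add_le _ _).trans ?_
      rw [abs_mul, abs_mul (1 - β₁), abs_of_pos hβ, abs_of_pos (sub_pos.2 hβ1)]
      linarith
    -- Convexity of the square, with weights `r` and `1 - r`.
    have h3 : (r * |p t| + (1 - β₁) * |c t|) ^ 2 ≤
        r * |p t| ^ 2 + (1 - β₁) ^ 2 / (1 - r) * |c t| ^ 2 := by
      have h4 : 0 ≤ r * (1 - r) * (|p t| - (1 - β₁) * |c t| / (1 - r)) ^ 2 := by positivity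
      have h5 : r * |p t| ^ 2 + (1 - β₁) ^ 2 / (1 - r) * |c t| ^ 2 -
          (r * |p t| + (1 - β₁) * |c t|) ^ 2 =
          r * (1 - r) * (|p t| - (1 - β₁) * |c t| / (1 - r)) ^ 2 := by
        field_simp; ring
      linarith
    rw [← sq_abs (p (t + 1)), ← sq_abs (p t), ← sq_abs (c t)]
    exact (pow_le_pow_left₀ (abs_nonneg _) h1 2).trans h3
  have h6 := Finset.sum_le_sum fun t (_ : t ∈ Finset.range T) => hstep t
  rw [Finset.sum_add_distrib, ← Finset.mul_sum, ← Finset.mul_sum] at h6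
  have h7 : ∑ t ∈ Finset.range T, p t ^ 2 ≤ ∑ t ∈ Finset.range T, p (t + 1) ^ 2 := by
    have h8 := Finset.sum_range_succ (fun t => p t ^ 2) T
    rw [Finset.sum_range_succ'] at h8
    have h9 : p 0 = 0 := by simp [p, h.m_zero]
    rw [h9] at h8
    nlinarith [sq_nonneg (p T)]
  have h10 : (1 - r) * ∑ t ∈ Finset.range T, p (t + 1) ^ 2 ≤
      (1 - β₁) ^ 2 / (1 - r) * ∑ t ∈ Finset.range T, c t ^ 2 := by
    nlinarith [mul_le_mul_of_nonneg_left h7 hr0.le]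
  calc ∑ t ∈ Finset.range T, p (t + 1) ^ 2
      ≤ ((1 - β₁) ^ 2 / (1 - r) * ∑ t ∈ Finset.range T, c t ^ 2) / (1 - r) := by
        rw [le_div_iff₀ hr1]; linarith
    _ = (1 - β₁) ^ 2 / (1 - r) ^ 2 * ∑ t ∈ Finset.range T, c t ^ 2 := by field_simp

end MomentRun

/-! ### The pathwise descent inequality -/

/-- `S` is a run of the AdaMM recursion driven by gradient estimates `g`, with zero initial
momentum, positive initial second moments, and estimates of norm at most `G`. -/
structure AdaMMRun {d : ℕ} (β₁ β₂ η ζ G : ℝ) (S : ℕ → AdaMMState d) (g : ℕ → Vec d) : Prop where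
  succ : ∀ t, S (t + 1) = adaMMStep β₁ β₂ η ζ (S t) (g t)
  m_zero : (S 0).m = 0
  v_zero : ∀ i, 0 < (S 0).v i
  bound : ∀ t, ‖g t‖ ≤ G

/-- The scaled momentum `m / √(v + ζ)`. -/
def scaledMomentum {d : ℕ} (ζ : ℝ) (s : AdaMMState d) : Vec d :=
  WithLp.toLp 2 fun i => s.m i * invScale ζ (s.v i)

/-- The auxiliary point `θ - (r / (1 - r)) η m / √(v + ζ)`, which absorbs the momentum. -/
def auxPoint {d : ℕ} (r η ζ : ℝ) (s : AdaMMState d) : Vec d :=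
  s.θ - (r / (1 - r) * η) • scaledMomentum ζ s

/-- The properties of a smoothed objective `Φ` with gradient `H` used in the descent argument. -/
structure SmoothWith {d : ℕ} (Φ : Vec d → ℝ) (H : Vec d → Fin d → ℝ) (L G : ℝ) : Prop where
  taylor : ∀ x y, Φ y ≤ Φ x + ∑ i, H x i * (y - x) i + L * √d / 2 * ‖y - x‖ ^ 2
  lipschitz : ∀ x y i, |H x i - H y i| ≤ L * ‖x - y‖
  bound : ∀ x i, |H x i| ≤ G
  nonneg : 0 ≤ L

namespace AdaMMRun

variable {d : ℕ} {β₁ β₂ η ζ G L : ℝ} {S : ℕ → AdaMMState d} {g : ℕ → Vec d}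
  {Φ : Vec d → ℝ} {H : Vec d → Fin d → ℝ}

lemma momentRun (h : AdaMMRun β₁ β₂ η ζ G S g) (i : Fin d) :
    MomentRun β₁ β₂ G (fun t => (S t).m i) (fun t => (S t).v i) (fun t => g t i) where
  m_zero := by simp [h.m_zero]
  v_zero := h.v_zero i
  m_succ t := by simp [h.succ, adaMMStep]
  v_succ t := by simp [h.succ, adaMMStep]
  bound t := (abs_coord_le_norm _ _).trans (h.bound t)

lemma θ_succ (h : AdaMMRun β₁ β₂ η ζ G S g) (t : ℕ) :
    (S (t + 1)).θ = (S t).θ - η • scaledMomentum ζ (S (t + 1)) := by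
  ext i
  simp [h.succ, adaMMStep, scaledMomentum, invScale, div_eq_mul_inv]

lemma auxPoint_succ_sub (h : AdaMMRun β₁ β₂ η ζ G S g) {r : ℝ} (hr : r < 1) (t : ℕ) :
    auxPoint r η ζ (S (t + 1)) - auxPoint r η ζ (S t) =
      -((η / (1 - r)) • (scaledMomentum ζ (S (t + 1)) - r • scaledMomentum ζ (S t))) := by
  have : 1 - r ≠ 0 := by linarith
  ext i
  simp only [auxPoint, h.θ_succ, PiLp.sub_apply, PiLp.smul_apply, PiLp.neg_apply, smul_eq_mul]
  field_simp
  ring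

/-- One step of descent at the auxiliary point. The momentum is split with the predictable scaling
`1 / √(vₜ + ζ)`; the mismatch with `1 / √(vₜ₊₁ + ζ)` telescopes. -/
lemma descent_step (h : AdaMMRun β₁ β₂ η ζ G S g) (hΦ : SmoothWith Φ H L G)
    (hβ : 0 < β₁) (hβ1 : β₁ < 1) (hb : 0 < β₂) (hb1 : β₂ < 1) (hr : β₁ < √β₂) (hζ : 0 < ζ)
    (hη : 0 < η) (t : ℕ) :
    Φ (auxPoint (β₁ / √β₂) η ζ (S (t + 1))) ≤ Φ (auxPoint (β₁ / √β₂) η ζ (S t))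
      - η / (1 - β₁ / √β₂) * ((1 - β₁) / √β₂ *
          ∑ i, H (S t).θ i * (g t i * invScale ζ ((S t).v i)))
      + η / (1 - β₁ / √β₂) * (G ^ 2 *
          ∑ i, (invScale ζ ((S t).v i) / √β₂ - invScale ζ ((S (t + 1)).v i)))
      + L * √d * (η / (1 - β₁ / √β₂)) ^ 2 *
          (3 / 2 * ‖scaledMomentum ζ (S (t + 1))‖ ^ 2 + 5 / 2 * ‖scaledMomentum ζ (S t)‖ ^ 2) := by
  have hs : 0 < √β₂ := Real.sqrt_pos.2 hb
  set r := β₁ / √β₂ with hr_def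
  have hr0 : 0 < r := div_pos hβ hs
  have hr1 : r < 1 := (div_lt_one hs).2 hr
  have h1r : 0 < 1 - r := sub_pos.2 hr1
  set z := auxPoint r η ζ (S t)
  set z' := auxPoint r η ζ (S (t + 1))
  set p := scaledMomentum ζ (S t) with hp
  set p' := scaledMomentum ζ (S (t + 1)) with hp'
  set a := η / (1 - r) with ha_def
  have ha : 0 < a := div_pos hη h1r
  have hδ : z' - z = -(a • (p' - r • p)) := h.auxPoint_succ_sub hr1 t
  have hδn : ‖z' - z‖ ≤ a * (‖p'‖ + ‖p‖) := by
    rw [hδ, norm_neg, norm_smul, Real.norm_of_nonneg ha.le]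
    gcongr
    refine (norm_sub_le _ _).trans ?_
    rw [norm_smul, Real.norm_of_nonneg hr0.le]
    nlinarith [norm_nonneg p]
  have hzθ : ‖z - (S t).θ‖ ≤ a * ‖p‖ := by
    have : z - (S t).θ = -((r / (1 - r) * η) • p) := by simp [z, auxPoint, p]
    rw [this, norm_neg, norm_smul, Real.norm_of_nonneg (by positivity)]
    gcongr
    rw [ha_def, div_mul_eq_mul_div]
    gcongr
    nlinarith
  -- Replace the gradient at the auxiliary point by the gradient at the iterate.
  have hgrad : ∑ i, H z i * (z' - z) i ≤ ∑ i, H (S t).θ i * (z' - z) i +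
      L * √d * a ^ 2 * (‖p‖ * (‖p'‖ + ‖p‖)) := by
    have h1 : ∑ i, H z i * (z' - z) i - ∑ i, H (S t).θ i * (z' - z) i ≤
        L * ‖z - (S t).θ‖ * ∑ i, |(z' - z) i| := by
      rw [← Finset.sum_sub_distrib, Finset.mul_sum]
      refine Finset.sum_le_sum fun i _ => ?_
      rw [← sub_mul]
      refine (le_abs_self _).trans ?_
      rw [abs_mul]
      exact mul_le_mul_of_nonneg_right (hΦ.lipschitz _ _ i) (abs_nonneg _)
    have h2 : L * ‖z - (S t).θ‖ * ∑ i, |(z' - z) i| ≤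
        L * (a * ‖p‖) * (√d * (a * (‖p'‖ + ‖p‖))) := by
      have hL := hΦ.nonneg
      refine mul_le_mul (by gcongr) ((sum_abs_le_sqrt_mul_norm _).trans (by gcongr))
        (Finset.sum_nonneg fun i _ => abs_nonneg _) (by positivity)
    have h3 : L * (a * ‖p‖) * (√d * (a * (‖p'‖ + ‖p‖))) =
        L * √d * a ^ 2 * (‖p‖ * (‖p'‖ + ‖p‖)) := by ring
    linarith
  have hfirst : ∑ i, H (S t).θ i * (z' - z) i ≤
      - a * ((1 - β₁) / √β₂ * ∑ i, H (S t).θ i * (g t i * invScale ζ ((S t).v i)))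
      + a * (G ^ 2 *
          ∑ i, (invScale ζ ((S t).v i) / √β₂ - invScale ζ ((S (t + 1)).v i))) := by
    rw [Finset.mul_sum, Finset.mul_sum, Finset.mul_sum, Finset.mul_sum, ← Finset.sum_add_distrib]
    refine Finset.sum_le_sum fun i _ => ?_
    have hm := h.momentRun i
    have hκ := sub_nonneg.2 (hm.invScale_succ_le hb hb1 hζ t)
    have hmb := hm.abs_m_le hβ hβ1 (t + 1)
    have hms := hm.m_succ t
    simp only at hκ hmb hms
    set s := invScale ζ ((S t).v i)
    set s' := invScale ζ ((S (t + 1)).v i)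
    have hpi : (p' - r • p) i = (1 - β₁) / √β₂ * (g t i * s) -
        (S (t + 1)).m i * (s / √β₂ - s') := by
      simp only [p, p', scaledMomentum, PiLp.sub_apply, PiLp.smul_apply, smul_eq_mul, hr_def, s, s']
      rw [hms]
      ring
    rw [hδ, PiLp.neg_apply, PiLp.smul_apply, smul_eq_mul, hpi]
    have h4 : H (S t).θ i * (S (t + 1)).m i ≤ G ^ 2 := by
      refine (le_abs_self _).trans ?_
      rw [abs_mul, sq]
      exact mul_le_mul (hΦ.bound _ i) hmb (abs_nonneg _)
        ((abs_nonneg _).trans (hΦ.bound (S t).θ i))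
    have h5 := mul_le_mul_of_nonneg_left (mul_le_mul_of_nonneg_right h4 hκ) ha.le
    linarith
  have htaylor := hΦ.taylor z z'
  have hquad : L * √d / 2 * ‖z' - z‖ ^ 2 ≤ L * √d / 2 * (a * (‖p'‖ + ‖p‖)) ^ 2 := by
    have := hΦ.nonneg
    gcongr
  have hyoung : (‖p‖ * (‖p'‖ + ‖p‖)) + (‖p'‖ + ‖p‖) ^ 2 / 2 ≤
      3 / 2 * ‖p'‖ ^ 2 + 5 / 2 * ‖p‖ ^ 2 := by
    nlinarith [sq_nonneg (‖p'‖ - ‖p‖)]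
  have hfin := mul_le_mul_of_nonneg_left hyoung
    (mul_nonneg (mul_nonneg hΦ.nonneg (Real.sqrt_nonneg d)) (sq_nonneg a))
  nlinarith

/-- The descent inequality summed over a run: the error consists of the telescoped mismatch of
scalings and of the second-order terms, controlled by logarithms of the second moments. -/
lemma sum_inner_le (h : AdaMMRun β₁ β₂ η ζ G S g) (hΦ : SmoothWith Φ H L G)
    (hβ : 0 < β₁) (hβ1 : β₁ < 1) (hb : 1 / 2 ≤ β₂) (hb1 : β₂ < 1) (hr : β₁ < √β₂) (hζ : 0 < ζ)
    (hη : 0 < η) {Φmin : ℝ} (hmin : ∀ x, Φmin ≤ Φ x) (T : ℕ) :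
    ∑ t ∈ Finset.range T, ∑ i, H (S t).θ i * (g t i * invScale ζ ((S t).v i)) / √β₂ ≤
      (1 - β₁ / √β₂) * (Φ (S 0).θ - Φmin) / (η * (1 - β₁))
      + d * G ^ 2 * (1 + T * (1 - β₂)) / ((1 - β₁) * √ζ)
      + 4 * L * η * √d * (1 - β₁) / (1 - β₁ / √β₂) ^ 3 *
        ((∑ i, Real.log ((β₂ ^ T * (S 0).v i + G ^ 2) / (S 0).v i) / (1 - β₂)) + 2 * d * T) := by
  have hb0 : 0 < β₂ := by linarith
  have hs : 0 < √β₂ := Real.sqrt_pos.2 hb0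
  have hstep := fun t => h.descent_step hΦ hβ hβ1 hb0 hb1 hr hζ hη t
  set r := β₁ / √β₂ with hr_def
  have hr0 : 0 < r := div_pos hβ hs
  have hr1 : r < 1 := (div_lt_one hs).2 hr
  have h1r : 0 < 1 - r := sub_pos.2 hr1
  have h1β : 0 < 1 - β₁ := sub_pos.2 hβ1
  set z := fun t => Φ (auxPoint r η ζ (S t))
  set P := fun t => ‖scaledMomentum ζ (S t)‖ ^ 2
  set I := fun t => ∑ i, H (S t).θ i * (g t i * invScale ζ ((S t).v i))
  set κ := fun t => ∑ i, (invScale ζ ((S t).v i) / √β₂ - invScale ζ ((S (t + 1)).v i))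
  set X := (∑ i, Real.log ((β₂ ^ T * (S 0).v i + G ^ 2) / (S 0).v i) / (1 - β₂)) + 2 * d * T
  set a := η / (1 - r) with ha_def
  have ha : 0 < a := div_pos hη h1r
  have hstep' : ∀ t, z (t + 1) ≤ z t - a * ((1 - β₁) / √β₂ * I t) + a * (G ^ 2 * κ t) +
      L * √d * a ^ 2 * (3 / 2 * P (t + 1) + 5 / 2 * P t) := hstep
  have hsum := Finset.sum_le_sum fun t (_ : t ∈ Finset.range T) => hstep' t
  simp only [Finset.sum_add_distrib, Finset.sum_sub_distrib, ← Finset.mul_sum] at hsum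
  have hz0 : z 0 = Φ (S 0).θ := by
    have : scaledMomentum ζ (S 0) = 0 := by ext i; simp [scaledMomentum, h.m_zero]
    simp [z, auxPoint, this]
  have htel : ∑ t ∈ Finset.range T, z (t + 1) = ∑ t ∈ Finset.range T, z t + (z T - z 0) := by
    rw [← Finset.sum_range_sub z T, ← Finset.sum_add_distrib]
    simp
  have hP0 : P 0 = 0 := by
    have : scaledMomentum ζ (S 0) = 0 := by ext i; simp [scaledMomentum, h.m_zero]
    simp [P, this]
  have hPsum : ∑ t ∈ Finset.range T, P t ≤ ∑ t ∈ Finset.range T, P (t + 1) := by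
    have h8 := Finset.sum_range_succ P T
    rw [Finset.sum_range_succ', hP0] at h8
    have : 0 ≤ P T := by positivity
    linarith
  have hPX : ∑ t ∈ Finset.range T, P (t + 1) ≤ (1 - β₁) ^ 2 / (1 - r) ^ 2 * X := by
    have h1 : ∀ t, P t = ∑ i, ((S t).m i * invScale ζ ((S t).v i)) ^ 2 := fun t => by
      simp only [P, EuclideanSpace.norm_sq_eq, scaledMomentum, Real.norm_eq_abs, sq_abs]
    simp only [h1]
    rw [Finset.sum_comm]
    have h2 : X = ∑ i, (Real.log ((β₂ ^ T * (S 0).v i + G ^ 2) / (S 0).v i) / (1 - β₂)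
        + 2 * (T : ℝ)) := by
      rw [Finset.sum_add_distrib]; simp [X]; ring
    rw [h2, Finset.mul_sum]
    refine Finset.sum_le_sum fun i _ => ?_
    refine ((h.momentRun i).sum_sq_scaled_momentum_le hβ hβ1 hb0 hb1 hr hζ T).trans ?_
    gcongr
    exact (h.momentRun i).sum_sq_mul_invScale_le hb hb1 hζ T
  have hκ : ∑ t ∈ Finset.range T, κ t ≤ d * ((1 + T * (1 - β₂)) / √ζ) := by
    simp only [κ]
    rw [Finset.sum_comm]
    refine (Finset.sum_le_sum fun i _ =>
      (h.momentRun i).sum_invScale_gap_le hb hb1 hζ T).trans (by simp)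
  have hmain : a * ((1 - β₁) / √β₂ * ∑ t ∈ Finset.range T, I t) ≤
      (Φ (S 0).θ - Φmin) + a * (G ^ 2 * (d * ((1 + T * (1 - β₂)) / √ζ)))
      + L * √d * a ^ 2 * (4 * ((1 - β₁) ^ 2 / (1 - r) ^ 2 * X)) := by
    have h1 : Φmin ≤ z T := hmin _
    have h2 : a * (G ^ 2 * ∑ t ∈ Finset.range T, κ t) ≤
        a * (G ^ 2 * (d * ((1 + T * (1 - β₂)) / √ζ))) := by gcongr
    have h3 : L * √d * a ^ 2 * (3 / 2 * ∑ t ∈ Finset.range T, P (t + 1) +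
        5 / 2 * ∑ t ∈ Finset.range T, P t) ≤
        L * √d * a ^ 2 * (4 * ((1 - β₁) ^ 2 / (1 - r) ^ 2 * X)) := by
      have := hΦ.nonneg
      gcongr
      linarith
    linarith
  have hpos : 0 < a * (1 - β₁) := mul_pos ha h1β
  rw [← Finset.sum_congr rfl fun t _ => Finset.sum_div _ _ _, ← Finset.sum_div]
  refine le_of_mul_le_mul_left ?_ hpos
  calc a * (1 - β₁) * ((∑ t ∈ Finset.range T, I t) / √β₂)
      = a * ((1 - β₁) / √β₂ * ∑ t ∈ Finset.range T, I t) := by ring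
    _ ≤ _ := hmain
    _ = _ := by
      rw [ha_def]
      field_simp

end AdaMMRun

/-! ### The zeroth-order gradient estimator -/

namespace ZOAssumptions

variable {d K : ℕ} {Ξ : Type*} [MeasurableSpace Ξ] {f : Vec d → Ξ → ℝ} {D : Measure Ξ}
  {C L σ μ : ℝ}

lemma partialsLipschitz (hA : ZOAssumptions f D C L σ) :
    PartialsLipschitz (objective f D) L :=
  ⟨hA.differentiable, hA.lipschitz⟩

lemma abs_objective_le [IsProbabilityMeasure D] (hA : ZOAssumptions f D C L σ) (θ : Vec d) :
    |objective f D θ| ≤ C := by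
  have h := norm_integral_le_of_norm_le_const (μ := D) (C := C) (f := f θ)
    (Eventually.of_forall fun x => hA.bounded θ x)
  simpa [objective] using h

lemma integrable [IsProbabilityMeasure D] (hA : ZOAssumptions f D C L σ) (θ : Vec d) :
    Integrable (f θ) D :=
  Integrable.of_bound (hA.measurable.comp measurable_prodMk_left).aestronglyMeasurable C
    (Eventually.of_forall fun x => hA.bounded θ x)

lemma measurable_comp (hA : ZOAssumptions f D C L σ) {α : Type*} [MeasurableSpace α]
    {a : α → Vec d} {b : α → Ξ} (ha : Measurable a) (hb : Measurable b) :
    Measurable fun q => f (a q) (b q) :=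
  hA.measurable.comp (ha.prodMk hb)

lemma measurable_two_point (hA : ZOAssumptions f D C L σ) {α : Type*} [MeasurableSpace α]
    {a c : α → Vec d} {b : α → Ξ} (ha : Measurable a) (hb : Measurable b) (hc : Measurable c) :
    Measurable fun q => ((f (a q + μ • c q) (b q) - f (a q) (b q)) / μ) • c q :=
  (((hA.measurable_comp (ha.add (hc.const_smul μ)) hb).sub (hA.measurable_comp ha hb)).div_const
    μ).smul hc

lemma measurable_zoGrad (hA : ZOAssumptions f D C L σ) {α : Type*} [MeasurableSpace α]
    {a : α → Vec d} {b : α → Ξ} {c : α → Fin K → Vec d} (ha : Measurable a) (hb : Measurable b)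
    (hc : Measurable c) : Measurable fun q => zoGrad f μ (c q) (b q) (a q) := by
  have h : Measurable fun q => ∑ k, ((f (a q + μ • c q k) (b q) - f (a q) (b q)) / μ) • c q k :=
    Finset.measurable_fun_sum _ fun k _ =>
      hA.measurable_two_point ha hb ((measurable_pi_apply k).comp hc)
  exact h.const_smul ((d : ℝ) / K)

lemma norm_two_point_le (hA : ZOAssumptions f D C L σ) (hμ : 0 < μ) {u : Vec d} (hu : ‖u‖ = 1)
    (x : Ξ) (θ : Vec d) : ‖((f (θ + μ • u) x - f θ x) / μ) • u‖ ≤ 2 * C / μ := by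
  rw [norm_smul, hu, mul_one, Real.norm_eq_abs, abs_div, abs_of_pos hμ]
  gcongr
  exact (abs_sub _ _).trans (by linarith [hA.bounded (θ + μ • u) x, hA.bounded θ x])

lemma norm_zoGrad_le (hA : ZOAssumptions f D C L σ) (hμ : 0 < μ) (hK : 1 ≤ K)
    {u : Fin K → Vec d} (hu : ∀ k, ‖u k‖ = 1) (x : Ξ) (θ : Vec d) :
    ‖zoGrad f μ u x θ‖ ≤ 2 * C * d / μ := by
  have hK' : (0 : ℝ) < K := by exact_mod_cast hK
  rw [zoGrad, norm_smul, Real.norm_of_nonneg (by positivity)]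
  have h1 : ‖∑ k, ((f (θ + μ • u k) x - f θ x) / μ) • u k‖ ≤ K * (2 * C / μ) := by
    refine (norm_sum_le _ _).trans ((Finset.sum_le_sum fun k _ =>
      hA.norm_two_point_le hμ (hu k) x θ).trans (by simp))
  calc (d : ℝ) / K * _ ≤ (d : ℝ) / K * (K * (2 * C / μ)) := by gcongr
    _ = _ := by field_simp

lemma integral_two_point [NeZero d] [IsProbabilityMeasure D] (hA : ZOAssumptions f D C L σ)
    (hμ : 0 < μ) (θ : Vec d) (i : Fin d) :
    Integrable (fun p : Ξ × Vec d => (((f (θ + μ • p.2) p.1 - f θ p.1) / μ) • p.2) i)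
      (D.prod (sphereUniform d)) ∧
    ∫ p : Ξ × Vec d, (((f (θ + μ • p.2) p.1 - f θ p.1) / μ) • p.2) i
      ∂(D.prod (sphereUniform d)) = smoothedPartial (objective f D) μ θ i / d := by
  have hmeas0 : Measurable fun p : Ξ × Vec d => ((f (θ + μ • p.2) p.1 - f θ p.1) / μ) • p.2 :=
    hA.measurable_two_point measurable_const measurable_fst measurable_snd
  have hmeas : Measurable fun p : Ξ × Vec d =>
      (((f (θ + μ • p.2) p.1 - f θ p.1) / μ) • p.2) i :=
    (measurable_pi_apply i).comp ((WithLp.measurable_ofLp 2 _).comp hmeas0)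
  have hint : Integrable (fun p : Ξ × Vec d => (((f (θ + μ • p.2) p.1 - f θ p.1) / μ) • p.2) i)
      (D.prod (sphereUniform d)) := by
    refine Integrable.of_bound hmeas.aestronglyMeasurable (2 * C / μ) ?_
    have h1 : ∀ᵐ p ∂(D.prod (sphereUniform d)), ‖p.2‖ = 1 :=
      Measure.quasiMeasurePreserving_snd.ae (ae_sphereUniform_norm_eq_one d)
    filter_upwards [h1] with p hp
    exact (abs_coord_le_norm _ i).trans (hA.norm_two_point_le hμ hp _ _)
  refine ⟨hint, ?_⟩
  rw [integral_prod_symm _ hint, ← hA.partialsLipschitz.integral_sphereUniform_two_point hμ]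
  congr 1 with u
  simp only [PiLp.smul_apply, smul_eq_mul]
  rw [integral_mul_const, integral_div, integral_sub (hA.integrable _) (hA.integrable _)]
  rfl

/-- The gradient estimator is unbiased for the gradient of the smoothed objective. -/
lemma integral_zoGrad [NeZero d] [IsProbabilityMeasure D] (hA : ZOAssumptions f D C L σ)
    (hμ : 0 < μ) (hK : 1 ≤ K) (θ : Vec d) (i : Fin d) :
    ∫ p : Ξ × (Fin K → Vec d), zoGrad f μ p.2 p.1 θ i
      ∂(D.prod (Measure.pi fun _ : Fin K => sphereUniform d)) =
      smoothedPartial (objective f D) μ θ i := by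
  have hK' : (0 : ℝ) < K := by exact_mod_cast hK
  have hd : (0 : ℝ) < d := Nat.cast_pos.2 (NeZero.pos d)
  obtain ⟨hint, hval⟩ := hA.integral_two_point hμ θ i
  have hmp : ∀ k : Fin K, MeasurePreserving (fun p : Ξ × (Fin K → Vec d) => (p.1, p.2 k))
      (D.prod (Measure.pi fun _ : Fin K => sphereUniform d)) (D.prod (sphereUniform d)) :=
    fun k => (MeasurePreserving.id D).prod
      (measurePreserving_eval (fun _ : Fin K => sphereUniform d) k)
  have hk : ∀ k : Fin K, ∫ p : Ξ × (Fin K → Vec d),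
      (((f (θ + μ • p.2 k) p.1 - f θ p.1) / μ) • p.2 k) i
      ∂(D.prod (Measure.pi fun _ : Fin K => sphereUniform d)) =
      smoothedPartial (objective f D) μ θ i / d := fun k => by
    rw [← hval, ← (hmp k).map_eq, integral_map (hmp k).measurable.aemeasurable
      (by rw [(hmp k).map_eq]; exact hint.aestronglyMeasurable)]
  have hki : ∀ k : Fin K, Integrable (fun p : Ξ × (Fin K → Vec d) =>
      (((f (θ + μ • p.2 k) p.1 - f θ p.1) / μ) • p.2 k) i)
      (D.prod (Measure.pi fun _ : Fin K => sphereUniform d)) := fun k =>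
    (hmp k).integrable_comp_of_integrable hint
  have he : ∀ p : Ξ × (Fin K → Vec d), zoGrad f μ p.2 p.1 θ i =
      (d : ℝ) / K * ∑ k, (((f (θ + μ • p.2 k) p.1 - f θ p.1) / μ) • p.2 k) i := fun p => by
    simp [zoGrad]
  simp only [he]
  rw [integral_const_mul, integral_finsetSum _ fun k _ => hki k]
  simp only [hk, Finset.sum_const, Finset.card_univ, Fintype.card_fin, nsmul_eq_mul]
  field_simp

end ZOAssumptions

/-! ### Measurability and independence of the iterates -/

lemma integral_comp_of_indepFun {Ω α β : Type*} [MeasurableSpace Ω] [MeasurableSpace α]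
    [MeasurableSpace β] {P : Measure Ω} [IsProbabilityMeasure P] {X : Ω → α} {Y : Ω → β}
    (hX : Measurable X) (hY : Measurable Y) (hXY : IndepFun X Y P) {φ : α × β → ℝ}
    (hφ : Measurable φ) (hint : Integrable (fun ω => φ (X ω, Y ω)) P) :
    ∫ ω, φ (X ω, Y ω) ∂P = ∫ ω, ∫ y, φ (X ω, y) ∂(P.map Y) ∂P := by
  have hmap := (indepFun_iff_map_prod_eq_prod_map_map hX.aemeasurable hY.aemeasurable).1 hXY
  have : IsProbabilityMeasure (P.map Y) := Measure.isProbabilityMeasure_map hY.aemeasurable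
  have : IsProbabilityMeasure (P.map X) := Measure.isProbabilityMeasure_map hX.aemeasurable
  have hφi : Integrable φ ((P.map X).prod (P.map Y)) := by
    rw [← hmap]
    exact (integrable_map_measure hφ.aestronglyMeasurable (hX.prodMk hY).aemeasurable).2 hint
  rw [← integral_map (hX.prodMk hY).aemeasurable (f := φ) hφ.aestronglyMeasurable, hmap,
    integral_prod _ hφi, integral_map hX.aemeasurable]
  exact hφ.stronglyMeasurable.integral_prod_right'.aestronglyMeasurable

/-- The components of a state as a triple `(θ, m, v)`. -/
def AdaMMState.triple {d : ℕ} (s : AdaMMState d) : Vec d × Vec d × Vec d := (s.θ, s.m, s.v)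

lemma measurable_invScale (ζ : ℝ) : Measurable (invScale ζ) :=
  measurable_const.div (Real.continuous_sqrt.measurable.comp (measurable_id.add_const ζ))

lemma measurable_adaMMStep {d : ℕ} (β₁ β₂ η ζ : ℝ) :
    Measurable fun q : (Vec d × Vec d × Vec d) × Vec d =>
      (adaMMStep β₁ β₂ η ζ ⟨q.1.1, q.1.2.1, q.1.2.2⟩ q.2).triple := by
  have hv : Measurable fun q : (Vec d × Vec d × Vec d) × Vec d =>
      (WithLp.toLp 2 fun i => β₂ * q.1.2.2 i + (1 - β₂) * q.2 i ^ 2 : Vec d) := by fun_prop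
  have hm : Measurable fun q : (Vec d × Vec d × Vec d) × Vec d =>
      β₁ • q.1.2.1 + (1 - β₁) • q.2 := by fun_prop
  have hdir : Measurable fun q : (Vec d × Vec d × Vec d) × Vec d =>
      (WithLp.toLp 2 fun i => (β₁ • q.1.2.1 + (1 - β₁) • q.2) i /
        √(β₂ * q.1.2.2 i + (1 - β₂) * q.2 i ^ 2 + ζ) : Vec d) := by
    refine (WithLp.measurable_toLp 2 _).comp (measurable_pi_lambda _ fun i => ?_)
    refine Measurable.div (by fun_prop) (Real.continuous_sqrt.measurable.comp (by fun_prop))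
  exact ((measurable_fst.comp measurable_fst).sub (hdir.const_smul η)).prodMk (hm.prodMk hv)

section Run

variable {d K : ℕ} {Ξ Ω : Type*} [MeasurableSpace Ξ] {f : Vec d → Ξ → ℝ}
  {D : Measure Ξ} {C L σ μ β₁ β₂ η ζ : ℝ} {θ₀ v₀ : Vec d}
  {ξ : ℕ → Ω → Ξ} {u : ℕ → Fin K → Ω → Vec d}

/-- The random state of ZO-AdaMM after `t` iterations. -/
def zoState (f : Vec d → Ξ → ℝ) (μ β₁ β₂ η ζ : ℝ) (θ₀ v₀ : Vec d) (ξ : ℕ → Ω → Ξ)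
    (u : ℕ → Fin K → Ω → Vec d) (t : ℕ) (ω : Ω) : AdaMMState d :=
  zoAdaMM f μ β₁ β₂ η ζ θ₀ 0 v₀ (fun s => ξ s ω) (fun s k => u s k ω) t

lemma measurable_triple_step (hA : ZOAssumptions f D C L σ) {α : Type*} {_ : MeasurableSpace α}
    {s : α → AdaMMState d} {y : α → Ξ × (Fin K → Vec d)} (hs : Measurable fun a => (s a).triple)
    (hy : Measurable y) :
    Measurable fun a =>
      (adaMMStep β₁ β₂ η ζ (s a) (zoGrad f μ (y a).2 (y a).1 (s a).θ)).triple :=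
  (measurable_adaMMStep β₁ β₂ η ζ).comp (hs.prodMk (hA.measurable_zoGrad
    (measurable_fst.comp hs) (measurable_fst.comp hy) (measurable_snd.comp hy)))

/-- The state after `t` iterations is a function of the samples of the iterations before `t`. -/
lemma measurable_triple_zoState (hA : ZOAssumptions f D C L σ) (t : ℕ) :
    Measurable[⨆ s ∈ Set.Iio t, MeasurableSpace.comap
      (fun ω => (ξ s ω, fun k => u s k ω)) inferInstance]
      fun ω => (zoState f μ β₁ β₂ η ζ θ₀ v₀ ξ u t ω).triple := by
  induction t with
  | zero =>
    exact @measurable_const _ _ _ (_) (θ₀, 0, v₀)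
  | succ t ih =>
    have h1 := ih.mono (iSup₂_mono' fun s hs => ⟨s, Set.mem_Iio.2
      ((Set.mem_Iio.1 hs).trans t.lt_succ_self), le_rfl⟩ :
      _ ≤ ⨆ s ∈ Set.Iio (t + 1), MeasurableSpace.comap
        (fun ω => (ξ s ω, fun k => u s k ω)) inferInstance) le_rfl
    have h2 : Measurable[⨆ s ∈ Set.Iio (t + 1), MeasurableSpace.comap
        (fun ω => (ξ s ω, fun k => u s k ω)) inferInstance]
        (fun ω => (ξ t ω, fun k => u t k ω)) :=
      (comap_measurable _).mono (le_iSup₂_of_le t (Set.mem_Iio.2 t.lt_succ_self) le_rfl) le_rfl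
    exact measurable_triple_step (s := zoState f μ β₁ β₂ η ζ θ₀ v₀ ξ u t)
      (y := fun ω => (ξ t ω, fun k => u t k ω)) hA h1 h2

variable [MeasurableSpace Ω] {P : Measure Ω}

lemma IsZOSampling.indepFun_state (hS : IsZOSampling D P ξ u) (hA : ZOAssumptions f D C L σ)
    (t : ℕ) : IndepFun (fun ω => (zoState f μ β₁ β₂ η ζ θ₀ v₀ ξ u t ω).triple)
      (fun ω => (ξ t ω, fun k => u t k ω)) P := by
  have h := indep_iSup_of_disjoint (fun s => (hS.measurable s).comap_le) hS.indep
    (S := Set.Iio t) (T := {t}) (by simp)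
  rw [IndepFun_iff_Indep]
  refine indep_of_indep_of_le_left (indep_of_indep_of_le_right h ?_) ?_
  · simp
  · exact (measurable_triple_zoState hA t).comap_le

lemma IsZOSampling.measurable_state (hS : IsZOSampling D P ξ u) (hA : ZOAssumptions f D C L σ)
    (t : ℕ) : Measurable fun ω => (zoState f μ β₁ β₂ η ζ θ₀ v₀ ξ u t ω).triple :=
  (measurable_triple_zoState hA t).mono
    (iSup₂_le fun s _ => (hS.measurable s).comap_le) le_rfl

lemma IsZOSampling.ae_norm_eq_one [NeZero d] [IsProbabilityMeasure D]
    (hS : IsZOSampling D P ξ u) : ∀ᵐ ω ∂P, ∀ t k, ‖u t k ω‖ = 1 := by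
  rw [ae_all_iff]; intro t
  rw [ae_all_iff]; intro k
  have h1 : ∀ᵐ p ∂(D.prod (Measure.pi fun _ : Fin K => sphereUniform d)), ‖p.2 k‖ = 1 :=
    Measure.quasiMeasurePreserving_snd.ae
      ((measurePreserving_eval (fun _ : Fin K => sphereUniform d) k).quasiMeasurePreserving.ae
        (ae_sphereUniform_norm_eq_one d))
  rw [← hS.law t] at h1
  exact ae_of_ae_map (hS.measurable t).aemeasurable h1

lemma IsZOSampling.ae_adaMMRun [NeZero d] [IsProbabilityMeasure D] (hS : IsZOSampling D P ξ u)
    (hA : ZOAssumptions f D C L σ) (hμ : 0 < μ) (hK : 1 ≤ K) (hv₀ : ∀ i, 0 < v₀ i) :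
    ∀ᵐ ω ∂P, AdaMMRun β₁ β₂ η ζ (2 * C * d / μ)
      (fun t => zoState f μ β₁ β₂ η ζ θ₀ v₀ ξ u t ω)
      (fun t => zoGrad f μ (fun k => u t k ω) (ξ t ω)
        (zoState f μ β₁ β₂ η ζ θ₀ v₀ ξ u t ω).θ) := by
  filter_upwards [hS.ae_norm_eq_one] with ω hω
  exact ⟨fun t => rfl, rfl, hv₀, fun t => hA.norm_zoGrad_le hμ hK (hω t) _ _⟩

lemma PartialsLipschitz.continuous_smoothedPartial {F : Vec d → ℝ} (hF : PartialsLipschitz F L)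
    (μ : ℝ) (i : Fin d) : Continuous fun θ => smoothedPartial F μ θ i := by
  refine (LipschitzWith.of_dist_le_mul (K := L.toNNReal) fun x y => ?_).continuous
  rw [Real.dist_eq, dist_eq_norm]
  exact (hF.abs_smoothedPartial_sub_le μ x y i).trans (by gcongr; exact Real.le_coe_toNNReal L)

lemma ZOAssumptions.smoothWith [NeZero d] [IsProbabilityMeasure D]
    (hA : ZOAssumptions f D C L σ) (hμ : 0 < μ) :
    SmoothWith (smoothed (objective f D) μ) (smoothedPartial (objective f D) μ) L
      (2 * C * d / μ) where
  taylor := hA.partialsLipschitz.smoothed_le_taylor μ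
  lipschitz := hA.partialsLipschitz.abs_smoothedPartial_sub_le μ
  bound := hA.partialsLipschitz.abs_smoothedPartial_le hμ hA.abs_objective_le
  nonneg := hA.partialsLipschitz.nonneg

end Run

/-! ### The averaged gradient bound -/

section Average

variable {d K : ℕ} {Ξ Ω : Type*} [MeasurableSpace Ξ] [MeasurableSpace Ω] {f : Vec d → Ξ → ℝ}
  {D : Measure Ξ} {P : Measure Ω} {C L σ μ β₁ β₂ η ζ : ℝ} {θ₀ v₀ : Vec d}
  {ξ : ℕ → Ω → Ξ} {u : ℕ → Fin K → Ω → Vec d}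

/-- The squared gradient of the smoothed objective, weighted by the AdaMM scaling. -/
def weightedGradSq (F : Vec d → ℝ) (μ ζ : ℝ) (s : AdaMMState d) : ℝ :=
  ∑ i, smoothedPartial F μ s.θ i * (smoothedPartial F μ s.θ i * invScale ζ (s.v i))

/-- The estimator may be replaced by its conditional mean, since the weight at step `t` only
depends on earlier samples. -/
lemma IsZOSampling.integral_weighted_estimator [NeZero d] [IsProbabilityMeasure D]
    [IsProbabilityMeasure P] (hS : IsZOSampling D P ξ u) (hA : ZOAssumptions f D C L σ)
    (hμ : 0 < μ) (hK : 1 ≤ K) (hζ : 0 < ζ) (hb : 0 < β₂) (hb1 : β₂ < 1) (hv₀ : ∀ i, 0 < v₀ i)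
    (t : ℕ) (i : Fin d) :
    let S := fun ω => zoState f μ β₁ β₂ η ζ θ₀ v₀ ξ u t ω
    let H := fun ω => smoothedPartial (objective f D) μ (S ω).θ i
    let g := fun ω => zoGrad f μ (fun k => u t k ω) (ξ t ω) (S ω).θ i
    Integrable (fun ω => H ω * (g ω * invScale ζ ((S ω).v i))) P ∧
    Integrable (fun ω => H ω * (H ω * invScale ζ ((S ω).v i))) P ∧
    ∫ ω, H ω * (g ω * invScale ζ ((S ω).v i)) ∂P =
      ∫ ω, H ω * (H ω * invScale ζ ((S ω).v i)) ∂P := by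
  intro S H g
  have hF := hA.partialsLipschitz
  have hHm : Measurable fun θ => smoothedPartial (objective f D) μ θ i :=
    (hF.continuous_smoothedPartial μ i).measurable
  have hX : Measurable fun ω => (S ω).triple := hS.measurable_state hA t
  have hsm : Measurable fun x : Vec d × Vec d × Vec d => invScale ζ (x.2.2 i) :=
    (measurable_invScale ζ).comp (by fun_prop)
  let φ : (Vec d × Vec d × Vec d) × (Ξ × (Fin K → Vec d)) → ℝ := fun q =>
    smoothedPartial (objective f D) μ q.1.1 i *
      (zoGrad f μ q.2.2 q.2.1 q.1.1 i * invScale ζ (q.1.2.2 i))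
  have hgm : Measurable fun q : (Vec d × Vec d × Vec d) × (Ξ × (Fin K → Vec d)) =>
      zoGrad f μ q.2.2 q.2.1 q.1.1 := hA.measurable_zoGrad (measurable_fst.comp measurable_fst)
    (measurable_fst.comp measurable_snd) (measurable_snd.comp measurable_snd)
  have hφ : Measurable φ := (hHm.comp (measurable_fst.comp measurable_fst)).mul
    (((measurable_pi_apply i).comp ((WithLp.measurable_ofLp 2 _).comp hgm)).mul
      (hsm.comp measurable_fst))
  have hψ : Measurable fun x : Vec d × Vec d × Vec d =>
      smoothedPartial (objective f D) μ x.1 i *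
        (smoothedPartial (objective f D) μ x.1 i * invScale ζ (x.2.2 i)) :=
    (hHm.comp measurable_fst).mul ((hHm.comp measurable_fst).mul hsm)
  have hrun := hS.ae_adaMMRun (β₁ := β₁) (β₂ := β₂) (η := η) (ζ := ζ) (θ₀ := θ₀) hA hμ hK hv₀
  have hHb : ∀ ω, |H ω| ≤ 2 * C * d / μ := fun ω => hF.abs_smoothedPartial_le hμ
    hA.abs_objective_le _ i
  have hbound : ∀ᵐ ω ∂P, |g ω| ≤ 2 * C * d / μ ∧ |invScale ζ ((S ω).v i)| ≤ 1 / √ζ := by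
    filter_upwards [hrun] with ω hω
    refine ⟨(hω.momentRun i).bound t, ?_⟩
    rw [abs_of_pos ((hω.momentRun i).invScale_pos hb hb1 hζ t)]
    exact (hω.momentRun i).invScale_le hb hb1 hζ t
  have hint : Integrable (fun ω => φ ((S ω).triple, (ξ t ω, fun k => u t k ω))) P := by
    refine Integrable.of_bound (hφ.comp (hX.prodMk (hS.measurable t))).aestronglyMeasurable
      (2 * C * d / μ * (2 * C * d / μ * (1 / √ζ))) ?_
    filter_upwards [hbound] with ω hω
    have h0 := (abs_nonneg _).trans (hHb ω)
    rw [Real.norm_eq_abs, abs_mul, abs_mul]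
    exact mul_le_mul (hHb ω) (mul_le_mul hω.1 hω.2 (abs_nonneg _) h0) (by positivity) h0
  have hint2 : Integrable (fun ω => H ω * (H ω * invScale ζ ((S ω).v i))) P := by
    refine Integrable.of_bound (hψ.comp hX).aestronglyMeasurable
      (2 * C * d / μ * (2 * C * d / μ * (1 / √ζ))) ?_
    filter_upwards [hbound] with ω hω
    have h0 := (abs_nonneg _).trans (hHb ω)
    rw [Real.norm_eq_abs, abs_mul, abs_mul]
    exact mul_le_mul (hHb ω) (mul_le_mul (hHb ω) hω.2 (abs_nonneg _) h0) (by positivity) h0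
  refine ⟨hint, hint2, ?_⟩
  have key := integral_comp_of_indepFun hX (hS.measurable t) (hS.indepFun_state hA t) hφ hint
  rw [hS.law t] at key
  refine key.trans ?_
  congr 1 with ω
  simp only [φ]
  rw [integral_const_mul, integral_mul_const, hA.integral_zoGrad hμ hK]
  rfl

/-- The expected weighted squared gradients along a run, summed over the first `T` iterations. -/
lemma IsZOSampling.sum_integral_weightedGradSq_le [NeZero d] [IsProbabilityMeasure D]
    [IsProbabilityMeasure P] (hS : IsZOSampling D P ξ u) (hA : ZOAssumptions f D C L σ)
    (hμ : 0 < μ) (hK : 1 ≤ K) (hζ : 0 < ζ) (hβ : 0 < β₁) (hβ1 : β₁ < 1) (hb : 1 / 2 ≤ β₂)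
    (hb1 : β₂ < 1) (hr : β₁ < √β₂) (hη : 0 < η) (hv₀ : ∀ i, 0 < v₀ i) (T : ℕ) :
    ∑ t ∈ Finset.range T, ∫ ω, weightedGradSq (objective f D) μ ζ
        (zoState f μ β₁ β₂ η ζ θ₀ v₀ ξ u t ω) ∂P ≤
      (1 - β₁ / √β₂) * (smoothed (objective f D) μ θ₀ - ⨅ θ, smoothed (objective f D) μ θ) /
        (η * (1 - β₁))
      + d * (2 * C * d / μ) ^ 2 * (1 + T * (1 - β₂)) / ((1 - β₁) * √ζ)
      + 4 * L * η * √d * (1 - β₁) / (1 - β₁ / √β₂) ^ 3 *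
        ((∑ i, Real.log ((β₂ ^ T * v₀ i + (2 * C * d / μ) ^ 2) / v₀ i) / (1 - β₂))
          + 2 * d * T) := by
  have hb0 : 0 < β₂ := by linarith
  have hs : 0 < √β₂ := Real.sqrt_pos.2 hb0
  have hs1 : √β₂ ≤ 1 := Real.sqrt_le_one.2 hb1.le
  have hbdd : BddBelow (Set.range fun θ => smoothed (objective f D) μ θ) :=
    ⟨-C, by rintro _ ⟨θ, rfl⟩; exact (abs_le.1 (abs_smoothed_le hA.abs_objective_le μ θ)).1⟩
  have hrun := hS.ae_adaMMRun (β₁ := β₁) (β₂ := β₂) (η := η) (ζ := ζ) (θ₀ := θ₀) hA hμ hK hv₀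
  have hid := fun t i => hS.integral_weighted_estimator (β₁ := β₁) (β₂ := β₂) (η := η) (θ₀ := θ₀)
    hA hμ hK hζ hb0 hb1 hv₀ t i
  simp only at hid
  have hmean : ∀ Q : ℝ, (∀ᵐ ω ∂P, ∑ t ∈ Finset.range T, ∑ i,
      smoothedPartial (objective f D) μ (zoState f μ β₁ β₂ η ζ θ₀ v₀ ξ u t ω).θ i *
        (zoGrad f μ (fun k => u t k ω) (ξ t ω) (zoState f μ β₁ β₂ η ζ θ₀ v₀ ξ u t ω).θ i *
          invScale ζ ((zoState f μ β₁ β₂ η ζ θ₀ v₀ ξ u t ω).v i)) / √β₂ ≤ Q) →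
      ∫ ω, ∑ t ∈ Finset.range T, ∑ i,
      smoothedPartial (objective f D) μ (zoState f μ β₁ β₂ η ζ θ₀ v₀ ξ u t ω).θ i *
        (zoGrad f μ (fun k => u t k ω) (ξ t ω) (zoState f μ β₁ β₂ η ζ θ₀ v₀ ξ u t ω).θ i *
          invScale ζ ((zoState f μ β₁ β₂ η ζ θ₀ v₀ ξ u t ω).v i)) / √β₂ ∂P ≤ Q := fun Q hQ => by
    have h := integral_mono_ae (μ := P) (integrable_finsetSum (Finset.range T) fun t _ =>
      integrable_finsetSum Finset.univ fun i _ => (hid t i).1.div_const (√β₂))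
      (integrable_const Q) hQ
    simpa using h
  refine le_trans ?_ (hmean _ (by
    filter_upwards [hrun] with ω hω
    exact hω.sum_inner_le (hA.smoothWith hμ) hβ hβ1 hb hb1 hr hζ hη (fun x => ciInf_le hbdd x) T))
  rw [integral_finsetSum _ fun t _ => integrable_finsetSum _ fun i _ =>
    (hid t i).1.div_const (√β₂)]
  refine Finset.sum_le_sum fun t _ => ?_
  simp only [weightedGradSq]
  rw [integral_finsetSum _ fun i _ => (hid t i).1.div_const (√β₂),
    integral_finsetSum _ fun i _ => (hid t i).2.1]
  refine Finset.sum_le_sum fun i _ => ?_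
  rw [integral_div, (hid t i).2.2, le_div_iff₀ hs]
  refine mul_le_of_le_one_right (integral_nonneg_of_ae ?_) hs1
  filter_upwards [hrun] with ω hω
  have h1 := ((hω.momentRun i).invScale_pos hb0 hb1 hζ t).le
  have h2 := mul_nonneg (mul_self_nonneg (smoothedPartial (objective f D) μ
    (zoState f μ β₁ β₂ η ζ θ₀ v₀ ξ u t ω).θ i)) h1
  simpa [mul_assoc] using h2

/-- The second moments never exceed `‖v₀‖ + G²`, so the weighted squared gradient controls the
gradient norm. -/
lemma AdaMMRun.norm_gradient_le [NeZero d] {F : Vec d → ℝ} (hF : PartialsLipschitz F L)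
    (hμ : 0 < μ) {G : ℝ} {S : ℕ → AdaMMState d} {g : ℕ → Vec d}
    (h : AdaMMRun β₁ β₂ η ζ G S g) (hG : 0 ≤ G) (hζ : 0 < ζ) (hb : 0 < β₂) (hb1 : β₂ < 1)
    {ε : ℝ} (hε : 0 < ε) (t : ℕ) :
    ‖gradient F (S t).θ‖ ≤ (√√ζ + √√‖(S 0).v‖ + √G) *
      ((weightedGradSq F μ ζ (S t) / ε + ε) / 2) + μ * L * √d := by
  set N := √√ζ + √√‖(S 0).v‖ + √G
  set A := weightedGradSq F μ ζ (S t)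
  set hvec : Vec d := WithLp.toLp 2 (smoothedPartial F μ (S t).θ)
  have hN : 0 ≤ N := by positivity
  -- `√(v + ζ) ≤ √ζ + √‖v₀‖ + G ≤ N²`
  have hscale : ∀ i, 1 ≤ N ^ 2 * invScale ζ ((S t).v i) := fun i => by
    have hm := h.momentRun i
    have hv := hm.v_pos hb hb1 t
    have hv0 := hm.v_zero
    have hvle := hm.v_le hb hb1 t
    simp only at hv hv0 hvle
    have h1 : (S t).v i ≤ ‖(S 0).v‖ + G ^ 2 := by
      have h2 : β₂ ^ t * (S 0).v i ≤ 1 * (S 0).v i :=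
        mul_le_mul_of_nonneg_right (pow_le_one₀ hb.le hb1.le) hv0.le
      have h3 := (le_abs_self _).trans (abs_coord_le_norm (S 0).v i)
      linarith
    have h4 : √((S t).v i + ζ) ≤ √ζ + √‖(S 0).v‖ + G := by
      refine Real.sqrt_le_iff.2 ⟨by positivity, ?_⟩
      have h5 := Real.sq_sqrt hζ.le
      have h6 := Real.sq_sqrt (norm_nonneg (S 0).v)
      have h7 : 0 ≤ √ζ * √‖(S 0).v‖ := by positivity
      have h8 : 0 ≤ √ζ * G := by positivity
      have h9 : 0 ≤ √‖(S 0).v‖ * G := by positivity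
      nlinarith
    have h5 : √ζ + √‖(S 0).v‖ + G ≤ N ^ 2 := by
      have h5 := Real.sq_sqrt (Real.sqrt_nonneg ζ)
      have h6 := Real.sq_sqrt (Real.sqrt_nonneg ‖(S 0).v‖)
      have h7 := Real.sq_sqrt hG
      have h8 : 0 ≤ √√ζ * √√‖(S 0).v‖ := by positivity
      have h9 : 0 ≤ √√ζ * √G := by positivity
      have h10 : 0 ≤ √√‖(S 0).v‖ * √G := by positivity
      simp only [N]
      nlinarith
    rw [invScale, mul_one_div, one_le_div (Real.sqrt_pos.2 (by positivity))]
    exact h4.trans h5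
  have hsq : ‖hvec‖ ^ 2 ≤ N ^ 2 * A := by
    rw [EuclideanSpace.norm_sq_eq]
    simp only [A, weightedGradSq, Finset.mul_sum]
    refine Finset.sum_le_sum fun i _ => ?_
    simp only [hvec, Real.norm_eq_abs, sq_abs]
    have := mul_le_mul_of_nonneg_left (hscale i) (mul_self_nonneg (smoothedPartial F μ (S t).θ i))
    linarith
  have hA0 : 0 ≤ A := Finset.sum_nonneg fun i _ => by
    rw [← mul_assoc]
    exact mul_nonneg (mul_self_nonneg _) ((h.momentRun i).invScale_pos hb hb1 hζ t).le
  -- AM-GM: `√A ≤ (A / ε + ε) / 2`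
  have hnorm : ‖hvec‖ ≤ N * ((A / ε + ε) / 2) := by
    refine abs_le_of_sq_le_sq' ?_ (by positivity) |>.2
    refine hsq.trans ?_
    rw [mul_pow]
    gcongr
    have h1 : A / ε * ε = A := div_mul_cancel₀ A hε.ne'
    nlinarith [sq_nonneg (A / ε - ε)]
  have hdiff : ‖gradient F (S t).θ - hvec‖ ≤ √d * (μ * L) := by
    refine norm_le_sqrt_mul_of_abs_le (mul_nonneg hμ.le hF.nonneg) fun i => ?_
    simpa [hvec] using hF.abs_smoothedPartial_sub_partial_le hμ.le (S t).θ i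
  calc ‖gradient F (S t).θ‖ = ‖hvec + (gradient F (S t).θ - hvec)‖ := by rw [add_sub_cancel]
    _ ≤ _ := norm_add_le _ _
    _ ≤ _ := by linarith

/-- If the expected weighted squared gradients average to at most `ε²`, the gradient norms average
to at most `(ζ^{1/4} + ‖v₀‖^{1/4} + √G) ε + μ L √d`. -/
theorem IsZOSampling.avgGradNormLE [NeZero d] [IsProbabilityMeasure D]
    [IsProbabilityMeasure P] (hS : IsZOSampling D P ξ u) (hA : ZOAssumptions f D C L σ)
    (hC : 0 ≤ C) (hμ : 0 < μ) (hK : 1 ≤ K) (hζ : 0 < ζ) (hb : 0 < β₂) (hb1 : β₂ < 1)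
    (hv₀ : ∀ i, 0 < v₀ i) {T : ℕ} (hT : 1 ≤ T) {ε : ℝ} (hε : 0 < ε)
    (hsum : ∑ t ∈ Finset.range T, ∫ ω, weightedGradSq (objective f D) μ ζ
        (zoState f μ β₁ β₂ η ζ θ₀ v₀ ξ u t ω) ∂P ≤ ε ^ 2 * T) :
    AvgGradNormLE (objective f D) P (zoAdaMMIterate f μ β₁ β₂ η ζ θ₀ v₀ ξ u) T
      ((√√ζ + √√‖v₀‖ + √(2 * C * d / μ)) * ε + μ * L * √d) := by
  have hF := hA.partialsLipschitz
  have hT' : (0 : ℝ) < T := by exact_mod_cast hT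
  have hrun := hS.ae_adaMMRun (β₁ := β₁) (β₂ := β₂) (η := η) (ζ := ζ) (θ₀ := θ₀) hA hμ hK hv₀
  have hm : ∀ t, Measurable fun ω => ‖gradient (objective f D)
      (zoState f μ β₁ β₂ η ζ θ₀ v₀ ξ u t ω).θ‖ := fun t =>
    (hF.continuous_gradient.measurable.comp
      (measurable_fst.comp (hS.measurable_state hA t))).norm
  have hint : ∀ t, Integrable (fun ω => ‖gradient (objective f D)
      (zoState f μ β₁ β₂ η ζ θ₀ v₀ ξ u t ω).θ‖) P := fun t => by
    refine Integrable.of_bound (hm t).aestronglyMeasurable (√d * (2 * C * d / μ + μ * L))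
      (Eventually.of_forall fun ω => ?_)
    rw [norm_norm]
    refine norm_le_sqrt_mul_of_abs_le
      (add_nonneg (by positivity) (mul_nonneg hμ.le hF.nonneg)) fun i => ?_
    have h1 := hF.abs_smoothedPartial_sub_partial_le hμ.le
      (zoState f μ β₁ β₂ η ζ θ₀ v₀ ξ u t ω).θ i
    have h2 := hF.abs_smoothedPartial_le hμ hA.abs_objective_le
      (zoState f μ β₁ β₂ η ζ θ₀ v₀ ξ u t ω).θ i
    rw [abs_le] at h1 h2 ⊢
    constructor <;> linarith [h1.1, h1.2, h2.1, h2.2]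
  have hAi : ∀ t, Integrable (fun ω => weightedGradSq (objective f D) μ ζ
      (zoState f μ β₁ β₂ η ζ θ₀ v₀ ξ u t ω)) P := fun t =>
    integrable_finsetSum _ fun i _ => (hS.integral_weighted_estimator hA hμ hK hζ hb hb1 hv₀ t i).2.1
  set N := √√ζ + √√‖v₀‖ + √(2 * C * d / μ)
  have hN : 0 ≤ N := by positivity
  have hle : ∀ t, ∫ ω, ‖gradient (objective f D)
      (zoState f μ β₁ β₂ η ζ θ₀ v₀ ξ u t ω).θ‖ ∂P ≤
      N * (((∫ ω, weightedGradSq (objective f D) μ ζ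
        (zoState f μ β₁ β₂ η ζ θ₀ v₀ ξ u t ω) ∂P) / ε + ε) / 2) + μ * L * √d := fun t => by
    have h1 := integral_mono_ae (μ := P) (hint t)
      (((hAi t).const_mul (N / (2 * ε))).add (integrable_const (N * ε / 2 + μ * L * √d))) (by
        filter_upwards [hrun] with ω hω
        refine (hω.norm_gradient_le hF hμ (by positivity) hζ hb hb1 hε t).trans (le_of_eq ?_)
        change N * ((weightedGradSq (objective f D) μ ζ _ / ε + ε) / 2) + _ = _
        simp only [Pi.add_apply]
        field_simp
        ring)
    refine h1.trans (le_of_eq ?_)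
    rw [integral_add' ((hAi t).const_mul _) (integrable_const _), integral_const_mul,
      integral_const, probReal_univ, one_smul]
    field_simp
    ring
  refine ⟨fun t _ => hint t, ?_⟩
  have hsum2 := Finset.sum_le_sum fun t (_ : t ∈ Finset.range T) => hle t
  rw [Finset.sum_add_distrib, ← Finset.mul_sum, ← Finset.sum_div, Finset.sum_add_distrib,
    ← Finset.sum_div] at hsum2
  simp only [Finset.sum_const, Finset.card_range, nsmul_eq_mul] at hsum2
  rw [one_div, inv_mul_le_iff₀ hT']
  refine hsum2.trans ?_
  have h2 := div_le_div_of_nonneg_right hsum hε.le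
  have h3 : ε ^ 2 * T / ε = ε * T := by field_simp
  rw [h3] at h2
  have h4 : N * ((ε * T + T * ε) / 2) + T * (μ * L * √d) = T * (N * ε + μ * L * √d) := by ring
  rw [← h4]
  gcongr

end Average

/-! ### Parameter choices -/

lemma rpow_one_fourth {x : ℝ} (hx : 0 ≤ x) : x ^ (1 / 4 : ℝ) = √√x := by
  rw [Real.sqrt_eq_rpow, Real.sqrt_eq_rpow, ← Real.rpow_mul hx]
  norm_num

/-- The logarithmic error term is nonnegative: it bounds the sum of squares of a run of the moment
recursion with zero gradient estimates. -/
lemma log_ratio_nonneg {β₂ G x : ℝ} (hb : 1 / 2 ≤ β₂) (hb1 : β₂ < 1) (hG : 0 ≤ G) (hx : 0 < x)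
    (T : ℕ) : 0 ≤ Real.log ((β₂ ^ T * x + G ^ 2) / x) / (1 - β₂) + 2 * T := by
  have h : MomentRun 0 β₂ G (fun _ => 0) (fun t => β₂ ^ t * x) (fun _ => 0) :=
    ⟨rfl, by simpa using hx, fun t => by simp, fun t => by simp [pow_succ]; ring, fun t => by
      simpa using hG⟩
  simpa using h.sum_sq_mul_invScale_le hb hb1 one_pos T

section Params

variable {d : ℕ} {C L μ ζ β₁ β₂ η ε Δ : ℝ} {v₀ : Vec d} {T : ℕ}

lemma AdmissibleParams.sum_bound_le (h : AdmissibleParams C L μ ζ β₁ β₂ η ε Δ v₀ T)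
    (hC : 0 ≤ C) (hL : 0 ≤ L) (hμ : 0 < μ) (hζ : 0 < ζ) (hβ : 0 < β₁) (hβ1 : β₁ < 1)
    (hb : 1 / 2 ≤ β₂) (hb1 : β₂ < 1) (hr : β₁ < √β₂) (hη : 0 < η) (hε : 0 < ε) (hΔ : 0 ≤ Δ)
    (hv₀ : ∀ i, 0 < v₀ i) :
    (1 - β₁ / √β₂) * Δ / (η * (1 - β₁))
      + d * (2 * C * d / μ) ^ 2 * (1 + T * (1 - β₂)) / ((1 - β₁) * √ζ)
      + 4 * L * η * √d * (1 - β₁) / (1 - β₁ / √β₂) ^ 3 *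
        ((∑ i, Real.log ((β₂ ^ T * v₀ i + (2 * C * d / μ) ^ 2) / v₀ i) / (1 - β₂))
          + 2 * d * T) ≤ ε ^ 2 * T := by
  have hb0 : 0 < β₂ := by linarith
  have hs : 0 < √β₂ := Real.sqrt_pos.2 hb0
  have hs1 : √β₂ ≤ 1 := Real.sqrt_le_one.2 hb1.le
  obtain ⟨h1, h2, h3⟩ := h
  have hsq : β₁ ^ 2 / β₂ = (β₁ / √β₂) ^ 2 := by rw [div_pow, Real.sq_sqrt hb0.le]
  rw [hsq] at h1 h3
  have hβr : β₁ ≤ β₁ / √β₂ := le_div_self hβ.le hs hs1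
  have hr1 : β₁ / √β₂ < 1 := (div_lt_one hs).2 hr
  set r := β₁ / √β₂
  have h1r : 0 < 1 - r := by linarith
  have h1r2 : 0 < 1 - r ^ 2 := by nlinarith
  have h1β : 0 < 1 - β₁ := by linarith
  have h1b : 0 < 1 - β₂ := by linarith
  set Λ := ∑ i, Real.log ((β₂ ^ T * v₀ i + (2 * C * d / μ) ^ 2) / v₀ i) / (1 - β₂) with hΛ
  have hG2 : 4 * C ^ 2 * d ^ 2 / μ ^ 2 = (2 * C * d / μ) ^ 2 := by ring
  rw [hG2, ← hΛ] at h3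
  set a1 := (1 - r) * Δ / (η * (1 - β₁))
  set a2 := 8 * C ^ 2 * d ^ 3 / ((1 - r ^ 2) * μ ^ 2 * √ζ)
  set a3 := 4 * L * η * √d * (1 - β₁) / (1 - r) ^ 3
  have ha1 : 0 ≤ a1 := by positivity
  have ha2 : 0 ≤ a2 := by positivity
  have ha3 : 0 ≤ a3 := by positivity
  have hΛ0 : 0 ≤ Λ + 2 * d * T := by
    have h4 : Λ + 2 * d * T = ∑ i, (Real.log ((β₂ ^ T * v₀ i + (2 * C * d / μ) ^ 2) / v₀ i) /
        (1 - β₂) + 2 * (T : ℝ)) := by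
      rw [Finset.sum_add_distrib]; simp [Λ]; ring
    rw [h4]
    exact Finset.sum_nonneg fun i _ => log_ratio_nonneg hb hb1 (by positivity) (hv₀ i) T
  -- `1 - r² = (1 - r)(1 + r) ≤ 2 (1 - β₁)`
  have hmid : d * (2 * C * d / μ) ^ 2 * (1 + T * (1 - β₂)) / ((1 - β₁) * √ζ) ≤
      a2 * (1 + T * (1 - β₂)) := by
    have h5 : d * (2 * C * d / μ) ^ 2 / ((1 - β₁) * √ζ) ≤ a2 := by
      have h6 : d * (2 * C * d / μ) ^ 2 / ((1 - β₁) * √ζ) =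
          8 * C ^ 2 * d ^ 3 / (2 * (1 - β₁) * μ ^ 2 * √ζ) := by field_simp; ring
      rw [h6]
      have : 1 - r ^ 2 ≤ 2 * (1 - β₁) := by nlinarith
      simp only [a2]
      gcongr
    calc _ = d * (2 * C * d / μ) ^ 2 / ((1 - β₁) * √ζ) * (1 + T * (1 - β₂)) := by ring
      _ ≤ _ := by gcongr
  have hc1 : (1 - β₂) * a2 ≤ ε ^ 2 / 3 := by
    refine le_trans ?_ h1
    have : 0 ≤ 2 * β₁ ^ 2 * d * √ζ / (1 - r ^ 2) := by positivity
    exact mul_le_mul_of_nonneg_left (by linarith) h1b.le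
  have hc2 : 4 * d * a3 ≤ ε ^ 2 / 3 := by
    refine le_trans (le_of_eq ?_) h2
    simp only [a3]; ring
  have hc3 : 2 * a1 + a2 + 2 * a3 * Λ ≤ ε ^ 2 / 3 * T := by
    have e1 : 2 * (1 - r) * Δ / (η * (1 - β₁)) = 2 * a1 := by simp only [a1]; ring
    have e2 : 8 * L * η * √d * (1 - β₁) / (1 - r) ^ 3 = 2 * a3 := by simp only [a3]; ring
    rw [e1, e2] at h3
    have h7 := mul_le_mul_of_nonneg_left h3 (by positivity : 0 ≤ ε ^ 2 / 3)
    have h8 : ε ^ 2 / 3 * (3 / ε ^ 2 * (2 * a1 + a2 + 2 * a3 * Λ)) =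
        2 * a1 + a2 + 2 * a3 * Λ := by field_simp
    rwa [h8] at h7
  have hT0 : (0 : ℝ) ≤ T := Nat.cast_nonneg T
  have h9 := mul_le_mul_of_nonneg_left hc1 hT0
  have h10 := mul_le_mul_of_nonneg_left hc2 hT0
  have h11 := mul_nonneg ha3 hΛ0
  linarith

/-- The bound on `1 - β₂` makes the first term of `convBound` dominate `√G ε`, where
`G = 2 C d / μ` bounds the gradient estimates. -/
lemma AdmissibleParams.le_convBound [NeZero d] (h : AdmissibleParams C L μ ζ β₁ β₂ η ε Δ v₀ T)
    (hC : 0 ≤ C) (hμ : 0 < μ) (hζ : 0 < ζ) (hβ : 0 < β₁) (hb : 0 < β₂) (hb1 : β₂ < 1)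
    (hr : β₁ < √β₂) (hε : 0 < ε) {S : ℝ} (hS : 0 ≤ S) :
    (√√ζ + √√‖v₀‖ + √(2 * C * d / μ)) * ε + μ * L * √d ≤
      convBound d β₁ β₂ ζ ε μ L (vHat v₀ β₁ S) := by
  have hd1 : (1 : ℝ) ≤ d := by exact_mod_cast NeZero.one_le
  have h1b : 0 < 1 - β₂ := by linarith
  have hrsq : β₁ ^ 2 / β₂ < 1 := by
    rw [div_lt_one hb, ← Real.sq_sqrt hb.le]
    gcongr
  have hrpos : 0 < β₁ ^ 2 / β₂ := by positivity
  have h1 := h.beta₂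
  set q := β₁ ^ 2 / β₂
  have h1q : 0 < 1 - q := by linarith
  set G := 2 * C * d / μ with hG
  have hG0 : 0 ≤ G := by positivity
  have hsζ : 0 < √ζ := Real.sqrt_pos.2 hζ
  -- AM-GM: `2 d G² / √ζ + 2 β₁² d √ζ ≥ 4 β₁ d G`
  have hamgm : 4 * β₁ * G ≤ 8 * C ^ 2 * d ^ 3 / ((1 - q) * μ ^ 2 * √ζ)
      + 2 * β₁ ^ 2 * d * √ζ / (1 - q) := by
    have h2 : 8 * C ^ 2 * d ^ 3 / ((1 - q) * μ ^ 2 * √ζ) + 2 * β₁ ^ 2 * d * √ζ / (1 - q) =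
        2 * d * ((G - β₁ * √ζ) ^ 2 / √ζ + 2 * β₁ * G) / (1 - q) := by
      rw [hG]; field_simp; ring
    rw [h2, le_div_iff₀ h1q]
    have h3 : 0 ≤ (G - β₁ * √ζ) ^ 2 / √ζ := by positivity
    have h4 : 0 ≤ β₁ * G := by positivity
    calc 4 * β₁ * G * (1 - q) ≤ 4 * β₁ * G * 1 := by gcongr; linarith
      _ ≤ 2 * 1 * (0 + 2 * β₁ * G) := by linarith
      _ ≤ _ := by gcongr
  have hGε : G * (β₁ * (1 - β₂)) ≤ ε ^ 2 := by
    have h5 := mul_le_mul_of_nonneg_left hamgm h1b.le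
    have h6 : 0 ≤ G * (β₁ * (1 - β₂)) := by positivity
    nlinarith [sq_nonneg ε]
  have hfirst : √G * ε ≤ (1 + β₁) * √d / √(β₁ * (1 - β₂)) * ε ^ 2 := by
    have hp : 0 < √(β₁ * (1 - β₂)) := Real.sqrt_pos.2 (by positivity)
    have h7 : √G * √(β₁ * (1 - β₂)) ≤ ε := by
      rw [← Real.sqrt_mul hG0]
      exact Real.sqrt_le_iff.2 ⟨hε.le, hGε⟩
    have h8 : 1 ≤ (1 + β₁) * √d := one_le_mul_of_one_le_of_one_le (by linarith)
      (Real.one_le_sqrt.2 hd1)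
    rw [div_mul_eq_mul_div, le_div_iff₀ hp]
    calc √G * ε * √(β₁ * (1 - β₂)) = √G * √(β₁ * (1 - β₂)) * ε := by ring
      _ ≤ ε * ε := by gcongr
      _ ≤ (1 + β₁) * √d * ε ^ 2 := by nlinarith
  have hv : √√‖v₀‖ ≤ √(vHat v₀ β₁ S * d) := by
    refine Real.sqrt_le_sqrt ?_
    calc √‖v₀‖ ≤ vHat v₀ β₁ S := Real.sqrt_le_sqrt (by
          have : 0 ≤ (1 + β₁) * S := by positivity
          linarith)
      _ ≤ _ := le_mul_of_one_le_right (Real.sqrt_nonneg _) hd1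
  rw [convBound, rpow_one_fourth hζ.le]
  have := mul_le_mul_of_nonneg_right hv hε.le
  linarith

end Params

/-- Convergence of ZO-AdaMM under the explicit parameter choice. -/
theorem IsZOSampling.avgGradNormLE_of_admissible {d K : ℕ} {Ξ Ω : Type*} [NeZero d]
    [MeasurableSpace Ξ] [MeasurableSpace Ω] {f : Vec d → Ξ → ℝ} {D : Measure Ξ}
    {P : Measure Ω} [IsProbabilityMeasure D] [IsProbabilityMeasure P]
    {C L σ μ β₁ β₂ η ζ ε : ℝ} {θ₀ v₀ : Vec d} {ξ : ℕ → Ω → Ξ} {u : ℕ → Fin K → Ω → Vec d} {T : ℕ}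
    (hS : IsZOSampling D P ξ u) (hA : ZOAssumptions f D C L σ) (hC : 0 ≤ C) (hL : 0 ≤ L)
    (hμ : 0 < μ) (hK : 1 ≤ K) (hζ : 0 < ζ) (hβ : 0 < β₁) (hβ1 : β₁ < 1)
    (hb : 1 / 2 ≤ β₂) (hb1 : β₂ < 1) (hr : β₁ < √β₂) (hη : 0 < η) (hε : 0 < ε)
    (hv₀ : ∀ i, 0 < v₀ i) (hT : 1 ≤ T)
    (hp : AdmissibleParams C L μ ζ β₁ β₂ η ε
      (smoothed (objective f D) μ θ₀ - ⨅ θ, smoothed (objective f D) μ θ) v₀ T) :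
    AvgGradNormLE (objective f D) P (zoAdaMMIterate f μ β₁ β₂ η ζ θ₀ v₀ ξ u) T
      (convBound d β₁ β₂ ζ ε μ L (vHat v₀ β₁ (sigmaSq d K σ C μ))) := by
  have hb0 : 0 < β₂ := by linarith
  have hbdd : BddBelow (Set.range fun θ => smoothed (objective f D) μ θ) :=
    ⟨-C, by rintro _ ⟨θ, rfl⟩; exact (abs_le.1 (abs_smoothed_le hA.abs_objective_le μ θ)).1⟩
  have hsum := (hS.sum_integral_weightedGradSq_le (θ₀ := θ₀) hA hμ hK hζ hβ hβ1 hb hb1 hr hη hv₀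
    T).trans (hp.sum_bound_le hC hL hμ hζ hβ hβ1 hb hb1 hr hη hε
      (sub_nonneg.2 (ciInf_le hbdd θ₀)) hv₀)
  obtain ⟨h1, h2⟩ := hS.avgGradNormLE (θ₀ := θ₀) hA hC hμ hK hζ hb0 hb1 hv₀ hT hε hsum
  refine ⟨h1, h2.trans (hp.le_convBound hC hμ hζ hβ hb0 hb1 hr hε ?_)⟩
  unfold sigmaSq
  positivity

/-- For `1 - β₂` and `η` at most small multiples of `ε²`, and `T` at least a large multiple of
`ε⁻⁴`, the parameters are admissible for every initial gap `Δ ≤ 2 C`. -/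
lemma exists_admissibleParams {d : ℕ} {C L μ ζ β₁ : ℝ} (hC : 0 ≤ C) (hL : 0 ≤ L) (hμ : 0 < μ)
    (hζ : 0 < ζ) (hβ : 0 < β₁) (hβ1 : β₁ < 1) :
    ∃ c₂ > 0, ∃ cη > 0, ∀ a₂ > 0, ∀ aη > 0, ∀ v₀ : Vec d, (∀ i, 0 < v₀ i) → ∃ cT > 0,
      ∀ (ε β₂ η Δ : ℝ) (T : ℕ), 0 < ε → ε ≤ 1 → 1 / 2 ≤ β₂ → β₂ < 1 → Δ ≤ 2 * C →
        a₂ * ε ^ 2 ≤ 1 - β₂ → 1 - β₂ ≤ c₂ * ε ^ 2 → aη * ε ^ 2 ≤ η → η ≤ cη * ε ^ 2 →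
        cT / ε ^ 4 ≤ (T : ℝ) →
        β₁ < √β₂ ∧ 0 < η ∧ 1 ≤ T ∧ AdmissibleParams C L μ ζ β₁ β₂ η ε Δ v₀ T := by
  have h1β : 0 < 1 - β₁ := by linarith
  -- The lower bound for `1 - β₁ / √β₂` that follows from `β₂ ≥ (1 + β₁) / 2`.
  obtain ⟨ρ, hρ⟩ : ∃ ρ, ρ = (1 - β₁) / (1 + β₁) := ⟨_, rfl⟩
  have hρ0 : 0 < ρ := by rw [hρ]; positivity
  obtain ⟨X, hX⟩ : ∃ X, X = 8 * C ^ 2 * d ^ 3 / (ρ * μ ^ 2 * √ζ) + 2 * β₁ ^ 2 * d * √ζ / ρ :=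
    ⟨_, rfl⟩
  have hX0 : 0 ≤ X := by rw [hX]; positivity
  obtain ⟨Y, hY⟩ : ∃ Y, Y = 16 * L * d * √(d : ℝ) * (1 - β₁) / ρ ^ 3 := ⟨_, rfl⟩
  have hY0 : 0 ≤ Y := by rw [hY]; positivity
  refine ⟨min ((1 - β₁) / 2) (1 / (3 * (X + 1))), by positivity, 1 / (3 * (Y + 1)), by positivity,
    fun a₂ ha₂ aη haη v₀ hv₀ => ?_⟩
  obtain ⟨cη, hcη⟩ : ∃ cη, cη = 1 / (3 * (Y + 1)) := ⟨_, rfl⟩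
  rw [← hcη]
  have hcη0 : 0 < cη := by rw [hcη]; positivity
  obtain ⟨Λ₀, hΛ₀⟩ : ∃ Λ₀, Λ₀ = ∑ i, Real.log ((v₀ i + 4 * C ^ 2 * d ^ 2 / μ ^ 2) / v₀ i) :=
    ⟨_, rfl⟩
  have hlog0 : ∀ i, 0 ≤ Real.log ((v₀ i + 4 * C ^ 2 * d ^ 2 / μ ^ 2) / v₀ i) := fun i => by
    refine Real.log_nonneg ?_
    rw [one_le_div (hv₀ i)]
    have : 0 ≤ 4 * C ^ 2 * d ^ 2 / μ ^ 2 := by positivity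
    linarith
  have hΛ₀0 : 0 ≤ Λ₀ := by rw [hΛ₀]; exact Finset.sum_nonneg fun i _ => hlog0 i
  obtain ⟨k1, hk1⟩ : ∃ k, k = 4 * C / (aη * (1 - β₁)) := ⟨_, rfl⟩
  obtain ⟨k2, hk2⟩ : ∃ k, k = 8 * C ^ 2 * d ^ 3 / (ρ * μ ^ 2 * √ζ) := ⟨_, rfl⟩
  obtain ⟨k3, hk3⟩ : ∃ k, k = 8 * L * cη * √(d : ℝ) * (1 - β₁) / ρ ^ 3 * (Λ₀ / a₂) := ⟨_, rfl⟩
  have hk1' : 0 ≤ k1 := by rw [hk1]; positivity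
  have hk2' : 0 ≤ k2 := by rw [hk2]; positivity
  have hk3' : 0 ≤ k3 := by rw [hk3]; positivity
  refine ⟨3 * (k1 + k2 + k3) + 1, by positivity, ?_⟩
  intro ε β₂ η Δ T hε hε1 hb hb1 hΔ hb2l hb2u hηl hηu hT
  have hb0 : 0 < β₂ := by linarith
  have hs : 0 < √β₂ := Real.sqrt_pos.2 hb0
  have hε2 : ε ^ 2 ≤ 1 := pow_le_one₀ hε.le hε1
  have hε2' : 0 < ε ^ 2 := by positivity
  have hη : 0 < η := lt_of_lt_of_le (by positivity) hηl
  have h1b : 0 < 1 - β₂ := by linarith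
  have hc2a : 1 - β₂ ≤ (1 - β₁) / 2 := by
    refine hb2u.trans ((mul_le_mul_of_nonneg_right (min_le_left _ _) hε2'.le).trans ?_)
    exact mul_le_of_le_one_right (by linarith) hε2
  have hc2b : 1 - β₂ ≤ 1 / (3 * (X + 1)) * ε ^ 2 :=
    hb2u.trans (mul_le_mul_of_nonneg_right (min_le_right _ _) hε2'.le)
  have hsb : β₂ ≤ √β₂ := Real.le_sqrt_of_sq_le (pow_le_of_le_one hb0.le hb1.le two_ne_zero)
  have hr : β₁ < √β₂ := by linarith
  have hrρ : ρ ≤ 1 - β₁ / √β₂ := by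
    have h1 : β₁ / √β₂ ≤ β₁ / ((1 + β₁) / 2) := by gcongr; linarith
    have h2 : ρ = 1 - β₁ / ((1 + β₁) / 2) := by rw [hρ]; field_simp; ring
    linarith
  have hsq : β₁ ^ 2 / β₂ = (β₁ / √β₂) ^ 2 := by rw [div_pow, Real.sq_sqrt hb0.le]
  have hr0 : 0 < β₁ / √β₂ := by positivity
  have hr2ρ : ρ ≤ 1 - β₁ ^ 2 / β₂ := by
    have : (β₁ / √β₂) ^ 2 ≤ β₁ / √β₂ := pow_le_of_le_one hr0.le (by linarith) two_ne_zero
    rw [hsq]; linarith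
  have hT0 : 0 < (T : ℝ) := lt_of_lt_of_le (by positivity) hT
  refine ⟨hr, hη, by exact_mod_cast hT0, ?_, ?_, ?_⟩
  · calc _ ≤ (1 - β₂) * X := by rw [hX]; gcongr
      _ ≤ 1 / (3 * (X + 1)) * ε ^ 2 * (X + 1) := by gcongr; linarith
      _ = ε ^ 2 / 3 := by field_simp
  · calc _ ≤ η * Y := by rw [hY]; gcongr
      _ ≤ cη * ε ^ 2 * (Y + 1) := by gcongr; linarith
      _ = ε ^ 2 / 3 := by rw [hcη]; field_simp
  · have ht1 : 2 * (1 - β₁ / √β₂) * Δ / (η * (1 - β₁)) ≤ k1 / ε ^ 2 := by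
      calc _ ≤ 2 * (1 - β₁ / √β₂) * (2 * C) / (η * (1 - β₁)) := by
            gcongr
            linarith
        _ ≤ 2 * 1 * (2 * C) / (aη * ε ^ 2 * (1 - β₁)) := by
            gcongr
            linarith
        _ = k1 / ε ^ 2 := by rw [hk1]; field_simp; ring
    have ht2 : 8 * C ^ 2 * d ^ 3 / ((1 - β₁ ^ 2 / β₂) * μ ^ 2 * √ζ) ≤ k2 / ε ^ 2 := by
      calc _ ≤ k2 := by rw [hk2]; gcongr
        _ ≤ _ := le_div_self hk2' hε2' hε2
    have hΛ : ∑ i, Real.log ((β₂ ^ T * v₀ i + 4 * C ^ 2 * d ^ 2 / μ ^ 2) / v₀ i) / (1 - β₂) ≤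
        Λ₀ / (a₂ * ε ^ 2) := by
      rw [hΛ₀, Finset.sum_div]
      refine Finset.sum_le_sum fun i _ => ?_
      have hvi := hv₀ i
      refine (div_le_div_of_nonneg_right (Real.log_le_log (by positivity) ?_) h1b.le).trans
        (div_le_div_of_nonneg_left (hlog0 i) (by positivity) hb2l)
      gcongr
      exact mul_le_of_le_one_left hvi.le (pow_le_one₀ hb0.le hb1.le)
    have ht3 : 8 * L * η * √(d : ℝ) * (1 - β₁) / (1 - β₁ / √β₂) ^ 3 *
        ∑ i, Real.log ((β₂ ^ T * v₀ i + 4 * C ^ 2 * d ^ 2 / μ ^ 2) / v₀ i) / (1 - β₂) ≤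
        k3 / ε ^ 2 := by
      have h1r : 0 < 1 - β₁ / √β₂ := by linarith
      calc _ ≤ 8 * L * η * √(d : ℝ) * (1 - β₁) / (1 - β₁ / √β₂) ^ 3 * (Λ₀ / (a₂ * ε ^ 2)) := by
            gcongr
        _ ≤ 8 * L * (cη * ε ^ 2) * √(d : ℝ) * (1 - β₁) / ρ ^ 3 * (Λ₀ / (a₂ * ε ^ 2)) := by
            gcongr
        _ = k3 := by rw [hk3]; field_simp
        _ ≤ _ := le_div_self hk3' hε2' hε2
    refine le_trans ?_ hT
    calc _ ≤ 3 / ε ^ 2 * (k1 / ε ^ 2 + k2 / ε ^ 2 + k3 / ε ^ 2) := by gcongr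
      _ = 3 * (k1 + k2 + k3) / ε ^ 4 := by field_simp
      _ ≤ _ := by gcongr; linarith

/-! ### The ratio of the two bounds -/

/-- A bound of the form `c + (k + √(√(A + B S) d)) ε + e` grows like `√(√B d) ε S^{1/4}`. -/
lemma tendsto_bound_div_fourth_root (c k e ε A B d : ℝ) :
    Tendsto (fun S : ℝ => (c + (k + √(√(A + B * S) * d)) * ε + e) / √√S) atTop
      (𝓝 (√(√B * d) * ε)) := by
  have hroot : Tendsto (fun S : ℝ => √√S) atTop atTop :=
    Real.tendsto_sqrt_atTop.comp Real.tendsto_sqrt_atTop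
  have h1 : Tendsto (fun S : ℝ => (c + k * ε + e) / √√S) atTop (𝓝 0) :=
    hroot.const_div_atTop _
  have h2 : Tendsto (fun S : ℝ => √(√(A / S + B) * d) * ε) atTop (𝓝 (√(√B * d) * ε)) := by
    have h3 : Tendsto (fun S : ℝ => A / S + B) atTop (𝓝 B) := by
      simpa using (tendsto_id.const_div_atTop A).add_const B
    exact ((h3.sqrt.mul_const d).sqrt).mul_const ε
  have h4 := h1.add h2
  rw [zero_add] at h4
  refine h4.congr' ?_
  filter_upwards [eventually_gt_atTop 0] with S hS
  have hS' : 0 < √√S := Real.sqrt_pos.2 (Real.sqrt_pos.2 hS)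
  have h5 : √(√(A + B * S) * d) = √(√(A / S + B) * d) * √√S := by
    have h6 : A + B * S = (A / S + B) * S := by field_simp
    rw [h6, Real.sqrt_mul' _ hS.le, mul_right_comm, Real.sqrt_mul' _ (Real.sqrt_nonneg S)]
  rw [h5]
  field_simp
  ring

lemma tendsto_convBound_ratio {d : ℕ} [NeZero d] {L μ ζ β₁ : ℝ} (hβ : 0 < β₁) (hβ1 : β₁ < 1)
    (v₀ : Vec d) {ε : ℝ} (β₂ η : ℝ) (hε : 0 < ε) :
    Tendsto (fun S : ℝ => convBound d β₁ β₂ ζ ε μ L (vHat v₀ β₁ S) /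
        convBound d β₁ β₂ ζ ε μ L (vRefined v₀ β₁ β₂ L η S))
      atTop (𝓝 (((1 + β₁) / (1 - β₁)) ^ (1 / 4 : ℝ))) := by
  have hd : (0 : ℝ) < d := Nat.cast_pos.2 (NeZero.pos d)
  have h1β : 0 < 1 - β₁ := by linarith
  have hnum := tendsto_bound_div_fourth_root
    ((1 + β₁) * √(d : ℝ) / √(β₁ * (1 - β₂)) * ε ^ 2) (ζ ^ (1 / 4 : ℝ)) (μ * L * √(d : ℝ)) ε
    ‖v₀‖ (1 + β₁) d
  have hden := tendsto_bound_div_fourth_root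
    ((1 + β₁) * √(d : ℝ) / √(β₁ * (1 - β₂)) * ε ^ 2) (ζ ^ (1 / 4 : ℝ)) (μ * L * √(d : ℝ)) ε
    (‖v₀‖ + β₁ * (1 + β₁) ^ 2 * L ^ 2 * η ^ 2 * d / ((1 - β₁) ^ 2 * (1 - β₂))) (1 - β₁) d
  have hlim := hnum.div hden (by positivity)
  have hval : √(√(1 + β₁) * d) * ε / (√(√(1 - β₁) * d) * ε) =
      ((1 + β₁) / (1 - β₁)) ^ (1 / 4 : ℝ) := by
    rw [rpow_one_fourth (by positivity), mul_div_mul_right _ _ hε.ne',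
      ← Real.sqrt_div' _ (by positivity), mul_div_mul_right _ _ hd.ne',
      ← Real.sqrt_div' _ h1β.le]
  rw [hval] at hlim
  refine hlim.congr' ?_
  filter_upwards [eventually_gt_atTop 0] with S hS
  have hS' : √√S ≠ 0 := (Real.sqrt_pos.2 (Real.sqrt_pos.2 hS)).ne'
  simp only [Pi.div_apply, convBound, vHat, vRefined]
  rw [div_div_div_cancel_right₀ hS', add_right_comm ‖v₀‖]

end

/-! ### Convergence of ZO-AdaMM and comparison with R-AdaZO -/

theorem mainTheorem5 (d : ℕ) (hd : 1 ≤ d) (C L μ ζ β₁ : ℝ)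
    (hC : 0 ≤ C) (hL : 0 ≤ L) (hμ : 0 < μ) (hζ : 0 < ζ) (hβ₁ : 0 < β₁) (hβ₁' : β₁ < 1) :
    -- convergence with `1 - β₂ ~ ε²`, `η ~ ε²`, `T ~ ε⁻⁴`
    (∃ c₂ > 0, ∃ cη > 0, ∀ a₂ > 0, ∀ aη > 0, ∀ v₀ : Vec d, (∀ i, 0 < v₀ i) → ∃ cT > 0,
      ∀ (Ξ : Type*) [MeasurableSpace Ξ] (D : Measure Ξ) [IsProbabilityMeasure D]
        (f : Vec d → Ξ → ℝ) (σ : ℝ), ZOAssumptions f D C L σ →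
      ∀ (K : ℕ), 1 ≤ K →
      ∀ (Ω : Type*) [MeasurableSpace Ω] (P : Measure Ω) [IsProbabilityMeasure P]
        (ξ : ℕ → Ω → Ξ) (u : ℕ → Fin K → Ω → Vec d), IsZOSampling D P ξ u →
      ∀ (θ₀ : Vec d) (ε β₂ η : ℝ) (T : ℕ), 0 < ε → ε ≤ 1 →
        1 / 2 ≤ β₂ → β₂ < 1 → β₁ ≤ √β₂ →
        a₂ * ε ^ 2 ≤ 1 - β₂ → 1 - β₂ ≤ c₂ * ε ^ 2 →
        aη * ε ^ 2 ≤ η → η ≤ cη * ε ^ 2 →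
        cT / ε ^ 4 ≤ (T : ℝ) →
        AvgGradNormLE (objective f D) P (zoAdaMMIterate f μ β₁ β₂ η ζ θ₀ v₀ ξ u) T
          (convBound d β₁ β₂ ζ ε μ L (vHat v₀ β₁ (sigmaSq d K σ C μ)))) ∧
    -- the same bound under the explicit parameter choice
    (∀ (Ξ : Type*) [MeasurableSpace Ξ] (D : Measure Ξ) [IsProbabilityMeasure D]
        (f : Vec d → Ξ → ℝ) (σ : ℝ), ZOAssumptions f D C L σ →
      ∀ (K : ℕ), 1 ≤ K →
      ∀ (Ω : Type*) [MeasurableSpace Ω] (P : Measure Ω) [IsProbabilityMeasure P]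
        (ξ : ℕ → Ω → Ξ) (u : ℕ → Fin K → Ω → Vec d), IsZOSampling D P ξ u →
      ∀ (θ₀ v₀ : Vec d) (ε β₂ η : ℝ) (T : ℕ), (∀ i, 0 < v₀ i) → 0 < ε →
        1 / 2 ≤ β₂ → β₂ < 1 → β₁ < √β₂ → 0 < η → 1 ≤ T →
        AdmissibleParams C L μ ζ β₁ β₂ η ε
          (smoothed (objective f D) μ θ₀ - ⨅ θ, smoothed (objective f D) μ θ) v₀ T →
        AvgGradNormLE (objective f D) P (zoAdaMMIterate f μ β₁ β₂ η ζ θ₀ v₀ ξ u) T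
          (convBound d β₁ β₂ ζ ε μ L (vHat v₀ β₁ (sigmaSq d K σ C μ)))) ∧
    -- ratio of the ZO-AdaMM bound to the R-AdaZO bound as the variance `S = Σ²` dominates
    (∀ (v₀ : Vec d) (ε β₂ η : ℝ), 0 < ε → 0 < β₂ → β₂ < 1 → 0 < η →
      Tendsto (fun S : ℝ => convBound d β₁ β₂ ζ ε μ L (vHat v₀ β₁ S) /
          convBound d β₁ β₂ ζ ε μ L (vRefined v₀ β₁ β₂ L η S))
        atTop (𝓝 (((1 + β₁) / (1 - β₁)) ^ (1 / 4 : ℝ)))) := by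
  have : NeZero d := ⟨by omega⟩
  refine ⟨?_, ?_, ?_⟩
  · obtain ⟨c₂, hc₂, cη, hcη, h⟩ := exists_admissibleParams (d := d) hC hL hμ hζ hβ₁ hβ₁'
    refine ⟨c₂, hc₂, cη, hcη, fun a₂ ha₂ aη haη v₀ hv₀ => ?_⟩
    obtain ⟨cT, hcT, h⟩ := h a₂ ha₂ aη haη v₀ hv₀
    refine ⟨cT, hcT, ?_⟩
    intro Ξ _ D _ f σ hA K hK Ω _ P _ ξ u hS θ₀ ε β₂ η T hε hε1 hb hb1 _ h1 h2 h3 h4 h5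
    have habs := fun θ => abs_le.1 (abs_smoothed_le hA.abs_objective_le μ θ)
    have hΔ : smoothed (objective f D) μ θ₀ - ⨅ θ, smoothed (objective f D) μ θ ≤ 2 * C := by
      have := le_ciInf fun θ => (habs θ).1
      linarith [(habs θ₀).2]
    obtain ⟨hr, hη, hT, hp⟩ := h ε β₂ η _ T hε hε1 hb hb1 hΔ h1 h2 h3 h4 h5
    exact hS.avgGradNormLE_of_admissible hA hC hL hμ hK hζ hβ₁ hβ₁' hb hb1 hr hη hε hv₀ hT hp
  · intro Ξ _ D _ f σ hA K hK Ω _ P _ ξ u hS θ₀ v₀ ε β₂ η T hv₀ hε hb hb1 hr hη hT hp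
    exact hS.avgGradNormLE_of_admissible hA hC hL hμ hK hζ hβ₁ hβ₁' hb hb1 hr hη hε hv₀ hT hp
  · intro v₀ ε β₂ η hε _ _ _
    exact tendsto_convBound_ratio hβ₁ hβ₁' v₀ β₂ η hε
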